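/- A virtual link diagram is a plane diagram of finitely many closed curves whose double points are marked as real (over/under) or virtual crossings; two diagrams are equivalent if they are related by a finite sequence of Reidemeister moves and virtual Reidemeister moves (the real moves, the purely virtual moves, and the mixed move passing a strand with two virtual crossings across a real crossing). A diagram is classical if it has no virtual crossing, and a diagram represents a classical link if it is equivalent to a classical diagram. For a state $s$ (a choice of A- or B-splice at every real crossing) let $\sharp D(s)$ be the number of components of the spliced diagram $D(s)$, and let $$\langle D\rangle=\sum_{s}A^{\alpha(s)-\beta(s)}(-A^2-A^{-2})^{\sharp D(s)-1}\in\mathbb{Z}[A,A^{-1}],$$ where $\alpha(s)$ and $\beta(s)$ are the numbers of A- and B-splices in $s$; $\mathrm{span}\langle D\rangle$ is the difference of the maximal and the minimal degree of $\langle D\rangle$. A diagram is adequate if $\sharp D(s)<\sharp D(s_A)$ for every state $s$ that differs from the all-A state $s_A$ at exactly one crossing, and $\sharp D(s)<\sharp D(s_B)$ for every state $s$ that differs from the all-B state $s_B$ at exactly one crossing. Corollary. Let $D'$ be an adequate classical link diagram, and let $D$ be obtained from $D'$ by replacing exactly one real crossing with a virtual crossing. Then $D$ does not represent any classical link. Moreover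 $\mathrm{span}\langle D\rangle=\mathrm{span}\langle D'\rangle-6$ and $\mathrm{span}\langle D\rangle$ is not divisible by $4$, whereas $\mathrm{span}\langle E\rangle$ is divisible by $4$ for every diagram $E$ that represents a classical link. -/

import Mathlib

/-!
Virtual link diagrams are encoded by planar diagram codes: a diagram is a finite plane graph whose
vertices are real crossings, virtual crossings and 2-valent marked points; its edges carry natural
numbers as names, and each vertex records the names of the edges around it in counterclockwise
order. Marked points carry no information (they may be inserted and removed freely); they make it
possible to have circles without crossings.
-/

/-- The kind of a crossing whose four edge ends are `a, b, c, d` in counterclockwise order, so that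
the two strands are `a`–`c` and `b`–`d`: a real crossing with `a`–`c` above, a real crossing with
`b`–`d` above, or a virtual crossing. -/
inductive CrossingKind where
  | overFirst
  | overSecond
  | virt
  deriving DecidableEq

namespace CrossingKind

/-- The kind of the same crossing when its edge ends are listed as `b, c, d, a`. -/
def rotate : CrossingKind → CrossingKind
  | overFirst => overSecond
  | overSecond => overFirst
  | virt => virt

end CrossingKind

/-- A vertex of a diagram, with the edges around it in counterclockwise order. -/
inductive DiagramNode where
  | crossing (k : CrossingKind) (a b c d : ℕ)
  | join (a b : ℕ)

namespace DiagramNode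

/-- The edge ends at a vertex, in counterclockwise order. -/
def ends : DiagramNode → List ℕ
  | crossing _ a b c d => [a, b, c, d]
  | join a b => [a, b]

/-- The pairs of edge ends that are consecutive along a strand passing through the vertex. -/
def strands : DiagramNode → List (ℕ × ℕ)
  | crossing _ a b c d => [(a, c), (b, d)]
  | join a b => [(a, b)]

/-- The vertex is a real crossing. -/
def IsReal : DiagramNode → Prop
  | crossing k _ _ _ _ => k ≠ CrossingKind.virt
  | join _ _ => False

/-- The vertex is a virtual crossing. -/
def IsVirtual : DiagramNode → Prop
  | crossing k _ _ _ _ => k = CrossingKind.virt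
  | join _ _ => False

instance : DecidablePred IsReal
  | crossing k _ _ _ _ => inferInstanceAs (Decidable (k ≠ CrossingKind.virt))
  | join _ _ => inferInstanceAs (Decidable False)

/-- Replace a crossing by a virtual crossing. -/
def virtualize : DiagramNode → DiagramNode
  | crossing _ a b c d => crossing CrossingKind.virt a b c d
  | join a b => join a b

/-- The A-splice of a real crossing: it merges the two regions that the upper strand sweeps out
when it is rotated counterclockwise. -/
def spliceA : DiagramNode → List DiagramNode
  | crossing CrossingKind.overFirst a b c d => [join b c, join d a]
  | crossing CrossingKind.overSecond a b c d => [join a b, join c d]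
  | n => [n]

/-- The B-splice of a real crossing: it merges the two other regions. -/
def spliceB : DiagramNode → List DiagramNode
  | crossing CrossingKind.overFirst a b c d => [join a b, join c d]
  | crossing CrossingKind.overSecond a b c d => [join b c, join d a]
  | n => [n]

end DiagramNode

/-- A planar diagram code: the list of the vertices. -/
abbrev PDCode := List DiagramNode

/-- The two ways of splicing a real crossing. -/
inductive Splice where
  | A
  | B
  deriving DecidableEq

instance : Fintype Splice := ⟨{Splice.A, Splice.B}, fun x => by cases x <;> simp⟩

namespace PDCode

/-- All edge ends, listed vertex by vertex. -/
def allEnds (C : PDCode) : List ℕ := C.flatMap DiagramNode.ends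

/-- The edges. -/
abbrev Edge (C : PDCode) : Type := {e : ℕ // e ∈ allEnds C}

/-- The edge ends (half-edges): a vertex together with a position around it. -/
abbrev Dart (C : PDCode) : Type := Σ i : Fin C.length, Fin (C.get i).ends.length

namespace Dart

/-- The edge on which an edge end lies. -/
def edge {C : PDCode} (x : Dart C) : ℕ := (C.get x.1).ends.get x.2

/-- The next edge end at the same vertex, counterclockwise. -/
def next {C : PDCode} (x : Dart C) : Dart C :=
  ⟨x.1, ⟨(x.2.1 + 1) % (C.get x.1).ends.length, Nat.mod_lt _ (x.2.pos)⟩⟩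

end Dart

/-- The number of faces of the rotation system: the boundary of a face is traced by following an
edge from one of its ends `x` to its other end `y`, and then turning into the edge end next to `y`. -/
noncomputable def numFaces (C : PDCode) : ℕ :=
  Nat.card (Quot fun x z : Dart C => ∃ y : Dart C, y ≠ x ∧ y.edge = x.edge ∧ z = y.next)

/-- The number of connected components of the underlying graph. -/
noncomputable def numPieces (C : PDCode) : ℕ :=
  Nat.card (Quot fun i j : Fin C.length => ∃ e, e ∈ (C.get i).ends ∧ e ∈ (C.get j).ends)

/-- The code is planar: every connected component of the underlying graph, with the given
cyclic orders at the vertices, has genus zero, that is, `V - E + F = 2` for each component. -/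
def IsPlanar (C : PDCode) : Prop :=
  C.length + numFaces C = Nat.card (Edge C) + 2 * numPieces C

/-- The number of link components (closed curves), strands passing straight through crossings. -/
noncomputable def numComponents (C : PDCode) : ℕ :=
  Nat.card (Quot fun x y : Edge C => ∃ n ∈ C, (x.1, y.1) ∈ n.strands)

/-- The set of the real crossings. -/
abbrev RealCrossing (C : PDCode) : Type := {i : Fin C.length // (C.get i).IsReal}

/-- A state: a choice of A or B for each real crossing. -/
abbrev State (C : PDCode) : Type := RealCrossing C → Splice

/-- The result of performing the splices prescribed by a state. -/
def splice (C : PDCode) (s : State C) : PDCode :=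
  (List.finRange C.length).flatMap fun i =>
    if h : (C.get i).IsReal then
      match s ⟨i, h⟩ with
      | Splice.A => (C.get i).spliceA
      | Splice.B => (C.get i).spliceB
    else [C.get i]

/-- The number of components after splicing. -/
noncomputable def stateComponents (C : PDCode) (s : State C) : ℕ := numComponents (splice C s)

open LaurentPolynomial in
/-- The weight `A^(α(s) - β(s)) (-A^2 - A^(-2))^(#D(s) - 1)` of a state. -/
noncomputable def weight (C : PDCode) (s : State C) : LaurentPolynomial ℤ :=
  T ((Finset.univ.filter fun p => s p = Splice.A).card -
      (Finset.univ.filter fun p => s p = Splice.B).card : ℤ) *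
    (-T 2 - T (-2)) ^ (stateComponents C s - 1)

/-- The Kauffman bracket polynomial. -/
noncomputable def bracket (C : PDCode) : LaurentPolynomial ℤ := ∑ s : State C, weight C s

/-- The state that sends every real crossing to `X`. -/
def constState (C : PDCode) (X : Splice) : State C := fun _ => X

/-- A-adequacy: changing the all-A state at any one crossing strictly lowers the number of
components. -/
def IsAAdequate (C : PDCode) : Prop :=
  ∀ p : RealCrossing C,
    stateComponents C (Function.update (constState C Splice.A) p Splice.B) <
      stateComponents C (constState C Splice.A)

/-- B-adequacy: changing the all-B state at any one crossing strictly lowers the number of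
components. -/
def IsBAdequate (C : PDCode) : Prop :=
  ∀ p : RealCrossing C,
    stateComponents C (Function.update (constState C Splice.B) p Splice.A) <
      stateComponents C (constState C Splice.B)

end PDCode

/-- The span of a Laurent polynomial: maximal degree minus minimal degree (`0` for the zero
polynomial). -/
noncomputable def laurentSpan (f : LaurentPolynomial ℤ) : ℤ :=
  if h : f.coeff.support.Nonempty then f.coeff.support.max' h - f.coeff.support.min' h else 0

/-- A virtual link diagram (unoriented). -/
structure VirtualLinkDiagram where
  /-- the vertices -/
  code : PDCode
  /-- every edge has exactly two ends -/
  two_ends : ∀ e ∈ code.allEnds, code.allEnds.count e = 2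
  /-- the underlying graph is a plane graph -/
  planar : code.IsPlanar

/-- The kinds `k₁₂, k₁₃, k₂₃` of the three crossings of strands 1, 2, 3 for which a strand may be
moved across the crossing of the two others. (`overFirst` in `kᵢⱼ` says that strand `i` is above
strand `j`.) Either all three are real and no strand lies cyclically above the next, or
all three are virtual, or exactly one is real. -/
def TriangleAllowed (k₁₂ k₁₃ k₂₃ : CrossingKind) : Prop :=
  (k₁₂ ≠ .virt ∧ k₁₃ ≠ .virt ∧ k₂₃ ≠ .virt ∧ ¬(k₁₂ = k₂₃ ∧ k₁₃ ≠ k₁₂)) ∨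
  (k₁₂ = .virt ∧ k₁₃ = .virt) ∨ (k₁₂ = .virt ∧ k₂₃ = .virt) ∨ (k₁₃ = .virt ∧ k₂₃ = .virt)

open DiagramNode in
/-- The local moves: a part of the diagram on the left is replaced by the one on the right.
The first four do not change the diagram in the plane (up to renaming edges and placing marked
points); the last three are the Reidemeister moves together with the virtual ones. -/
inductive LocalMove : List DiagramNode → List DiagramNode → Prop
  /-- a crossing may be listed starting from any of its edge ends -/
  | rotate (k : CrossingKind) (a b c d : ℕ) :
      LocalMove [crossing k a b c d] [crossing k.rotate b c d a]
  /-- a marked point may be listed starting from any of its edge ends -/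
  | flip (a b : ℕ) : LocalMove [join a b] [join b a]
  /-- placing a marked point on an edge next to a crossing -/
  | markCrossing (k : CrossingKind) (a b c d x : ℕ) :
      LocalMove [crossing k a b c d] [crossing k x b c d, join x a]
  /-- placing a marked point on an edge next to a marked point -/
  | markJoin (a b x : ℕ) : LocalMove [join a b] [join a x, join x b]
  /-- first move (real or virtual): removing a curl -/
  | move₁ (k : CrossingKind) (a b x : ℕ) :
      LocalMove [crossing k x x a b] [join a b]
  /-- second move (real or virtual): pulling apart the strands `a x b` and `c y d` -/
  | move₂ (k : CrossingKind) (a b c d x y : ℕ) :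
      LocalMove [crossing k a c x y, crossing k b y x d] [join a b, join c d]
  /-- third move (real, virtual or mixed): strands 1, 2, 3 run from `a` to `p`, from `b` to `q` and
  from `c` to `r`, where `a, b, c, p, q, r` is the counterclockwise order of these ends -/
  | move₃ (k₁₂ k₁₃ k₂₃ : CrossingKind) (h : TriangleAllowed k₁₂ k₁₃ k₂₃)
      (a b c p q r x y z u v w : ℕ) :
      LocalMove
        [crossing k₁₂ a b x y, crossing k₁₃ x c p z, crossing k₂₃ y z q r]
        [crossing k₁₂ u v p q, crossing k₁₃ a w u r, crossing k₂₃ b c v w]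

namespace VirtualLinkDiagram

/-- The two diagrams differ by one local move (and the order in which vertices are listed). -/
def Step (D E : VirtualLinkDiagram) : Prop :=
  ∃ l r rest : List DiagramNode, LocalMove l r ∧
    D.code.Perm (l ++ rest) ∧ E.code.Perm (r ++ rest)

/-- Equivalence of virtual link diagrams: a finite sequence of (virtual) Reidemeister moves and
their inverses. -/
def Equivalent (D E : VirtualLinkDiagram) : Prop := Relation.EqvGen Step D E

/-- A classical diagram: one without virtual crossings. -/
def IsClassical (D : VirtualLinkDiagram) : Prop := ∀ n ∈ D.code, ¬ n.IsVirtual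

/-- The diagram represents a classical link. -/
def RepresentsClassicalLink (D : VirtualLinkDiagram) : Prop :=
  ∃ E : VirtualLinkDiagram, E.IsClassical ∧ D.Equivalent E

/-- Adequate diagrams. -/
def IsAdequate (D : VirtualLinkDiagram) : Prop := D.code.IsAAdequate ∧ D.code.IsBAdequate

/-- The span of the Kauffman bracket. -/
noncomputable def bracketSpan (D : VirtualLinkDiagram) : ℤ := laurentSpan D.code.bracket

/-- `D` is obtained from `D'` by virtualizing exactly one real crossing. -/
def IsVirtualizationOf (D D' : VirtualLinkDiagram) : Prop :=
  ∃ p : D'.code.RealCrossing, D.code = D'.code.set p.1 (D'.code.get p.1).virtualize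

end VirtualLinkDiagram

/-! ### Cardinalities of quotients. -/

section QuotientCard

/-! The argument compares states that differ at one crossing. A classical diagram is a plane graph
with vertices of even degree, so its faces have a checkerboard colouring. This orients the edges so
that the four ends at each crossing are alternately incoming and outgoing (`SourceSink`). Both
splices respect such an orientation. Outside one crossing, a spliced diagram therefore consists of
directed paths, and these never join the two incoming ends to each other. Hence the two splices of
the crossing differ by exactly one component, and making it virtual gives the smaller of the two
numbers (`comps_directed_tangle`, `SourceSink.tangle`).

Divisibility by 4: switching one splice changes the exponent of `A` by 2 and the degree of the loop
factor by 2 as well, so all exponents of the bracket of a classical diagram agree modulo 4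
(`SourceSink.coeff_skein_mod`). Every move multiplies the bracket by `±A^k` (`LocalMove.skein_eq`),
so the span is an invariant and the divisibility passes to all diagrams of classical links.

The drop by 6: if no single change of splice raises the number of components above that of the all-A
or of the all-B state, the extreme terms of these states survive and the span is `2n + 2(♯s_A - 1) +
2(♯s_B - 1)`, where `n` counts the real crossings (`laurentSpan_bracket`). This applies to `D'` by
adequacy. Virtualizing a crossing lowers each of `n`, `♯s_A` and `♯s_B` by one, and adequacy
survives in the weak form that the formula needs (`StrictlyAdequate.virtualize`). Finally, a
multiple of 4 minus 6 is not a multiple of 4. -/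

theorem card_quot_congr {α β : Type*} {r : α → α → Prop} {s : β → β → Prop} (f : α → β) (g : β → α)
    (hf : ∀ x y, r x y → Relation.EqvGen s (f x) (f y))
    (hg : ∀ x y, s x y → Relation.EqvGen r (g x) (g y))
    (hgf : ∀ x, Relation.EqvGen r (g (f x)) x) (hfg : ∀ y, Relation.EqvGen s (f (g y)) y) :
    Nat.card (Quot r) = Nat.card (Quot s) := by
  refine Nat.card_congr ⟨Quot.lift (fun x => Quot.mk s (f x)) fun x y h => Quot.eqvGen_sound (hf x y h),
    Quot.lift (fun x => Quot.mk r (g x)) fun x y h => Quot.eqvGen_sound (hg x y h), ?_, ?_⟩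
  · rintro ⟨x⟩
    exact Quot.eqvGen_sound (hgf x)
  · rintro ⟨x⟩
    exact Quot.eqvGen_sound (hfg x)

/-- Gluing two points lowers the number of classes by at most one. -/
theorem card_quot_le_succ {α : Type*} [Finite α] {r r' : α → α → Prop} (u v : α)
    (h : ∀ x y, r' x y → r x y ∨ (x = u ∧ y = v)) (h' : ∀ x y, r x y → r' x y) :
    Nat.card (Quot r) ≤ Nat.card (Quot r') + 1 := by
  classical
  let π : Quot r → Quot r' := Quot.map id h'
  -- A left inverse of `π` away from the class of `u`. Sending that class to the class of `v` makes
  -- it respect the additional relation.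
  let σ : Quot r' → Quot r := Quot.lift
    (fun x => if Quot.mk r x = Quot.mk r u then Quot.mk r v else Quot.mk r x) (by
      intro x y hxy
      rcases h x y hxy with hr | ⟨rfl, rfl⟩
      · simp only [Quot.sound hr]
      · simp)
  have hσ : ∀ q, q ≠ Quot.mk r u → σ (π q) = q := by
    rintro ⟨x⟩ hx
    exact if_neg hx
  rw [← Finite.card_option]
  refine Nat.card_le_card_of_injective (fun q => if q = Quot.mk r u then none else some (π q)) ?_
  intro p q hpq
  by_cases hp : p = Quot.mk r u <;> by_cases hq : q = Quot.mk r u <;> simp [hp, hq] at hpq ⊢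
  rw [← hσ p hp, hpq, hσ q hq]

end QuotientCard

/-! ### Lists of arcs and their numbers of components. -/

/-- Lists of arcs, given by the names of their end points. -/
abbrev ArcList := List (ℕ × ℕ)

namespace ArcList

/-- The end points of the arcs. -/
def ends (P : ArcList) : List ℕ := P.flatMap fun p => [p.1, p.2]

@[simp] theorem ends_nil : ends [] = [] := rfl

@[simp] theorem ends_cons (p : ℕ × ℕ) (P : ArcList) : ends (p :: P) = p.1 :: p.2 :: ends P := rfl

@[simp] theorem ends_append (P Q : ArcList) : ends (P ++ Q) = ends P ++ ends Q := by
  simp [ends]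

theorem mem_ends_left {P : ArcList} {x y : ℕ} (h : (x, y) ∈ P) : x ∈ ends P :=
  List.mem_flatMap.2 ⟨_, h, by simp⟩

theorem mem_ends_right {P : ArcList} {x y : ℕ} (h : (x, y) ∈ P) : y ∈ ends P :=
  List.mem_flatMap.2 ⟨_, h, by simp⟩

/-- The number of components of the union of the arcs. -/
noncomputable def comps (P : ArcList) : ℕ :=
  Nat.card (Quot fun x y : {e // e ∈ ends P} => (x.1, y.1) ∈ P)

/-- Two points are connected by a chain of arcs. -/
def Conn (P : ArcList) : ℕ → ℕ → Prop := Relation.EqvGen fun x y => (x, y) ∈ P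

theorem Conn.of_mem {P : ArcList} {x y : ℕ} (h : (x, y) ∈ P) : Conn P x y := .rel _ _ h

theorem Conn.refl {P : ArcList} (x : ℕ) : Conn P x x := Relation.EqvGen.refl _

theorem Conn.symm {P : ArcList} {x y : ℕ} (h : Conn P x y) : Conn P y x := Relation.EqvGen.symm _ _ h

theorem Conn.trans {P : ArcList} {x y z : ℕ} (h : Conn P x y) (h' : Conn P y z) : Conn P x z :=
  Relation.EqvGen.trans _ _ _ h h'

theorem Conn.eqvGen_subtype {P : ArcList} {x y : ℕ} (h : Conn P x y) (hx : x ∈ ends P) (hy : y ∈ ends P) :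
    Relation.EqvGen (fun x y : {e // e ∈ ends P} => (x.1, y.1) ∈ P) ⟨x, hx⟩ ⟨y, hy⟩ := by
  -- A chain in `ℕ` may contain trivial steps at numbers that are not end points, so the induction
  -- carries equality as a separate case.
  have key : x = y ∨ ∃ hx hy,
      Relation.EqvGen (fun x y : {e // e ∈ ends P} => (x.1, y.1) ∈ P) ⟨x, hx⟩ ⟨y, hy⟩ := by
    clear hx hy
    induction h with
    | rel x y h => exact .inr ⟨mem_ends_left h, mem_ends_right h, .rel _ _ h⟩
    | refl x => exact .inl rfl
    | symm x y _ ih =>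
      rcases ih with rfl | ⟨h1, h2, h3⟩
      · exact .inl rfl
      · exact .inr ⟨h2, h1, h3.symm⟩
    | trans x y z _ _ ih ih' =>
      rcases ih with rfl | ⟨h1, h2, h3⟩
      · exact ih'
      · rcases ih' with rfl | ⟨h1', h2', h3'⟩
        · exact .inr ⟨h1, h2, h3⟩
        · exact .inr ⟨h1, h2', h3.trans _ _ _ h3'⟩
  rcases key with rfl | ⟨_, _, h⟩
  · exact .refl _
  · exact h

/-- The two maps need to be mutually inverse only up to connection, which allows a point to be
collapsed onto a neighbour. -/
theorem comps_congr {P Q : ArcList} (f g : ℕ → ℕ)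
    (hf : ∀ x ∈ ends P, f x ∈ ends Q) (hg : ∀ x ∈ ends Q, g x ∈ ends P)
    (hPQ : ∀ x y, (x, y) ∈ P → Conn Q (f x) (f y)) (hQP : ∀ x y, (x, y) ∈ Q → Conn P (g x) (g y))
    (hgf : ∀ x ∈ ends P, Conn P (g (f x)) x) (hfg : ∀ x ∈ ends Q, Conn Q (f (g x)) x) :
    comps P = comps Q :=
  card_quot_congr (fun x => ⟨f x.1, hf _ x.2⟩) (fun x => ⟨g x.1, hg _ x.2⟩)
    (fun x y h => (hPQ x.1 y.1 h).eqvGen_subtype _ _) (fun x y h => (hQP x.1 y.1 h).eqvGen_subtype _ _)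
    (fun x => (hgf x.1 x.2).eqvGen_subtype _ _) (fun x => (hfg x.1 x.2).eqvGen_subtype _ _)

/-- The number of components depends only on the end points and on which of them are connected. -/
theorem comps_eq_of_conn {P Q : ArcList} (h : ∀ x, x ∈ ends P ↔ x ∈ ends Q)
    (hPQ : ∀ x y, (x, y) ∈ P → Conn Q x y) (hQP : ∀ x y, (x, y) ∈ Q → Conn P x y) :
    comps P = comps Q :=
  comps_congr id id (fun x hx => (h x).1 hx) (fun x hx => (h x).2 hx) hPQ hQP
    (fun _ _ => .refl _) (fun _ _ => .refl _)

theorem comps_perm {P Q : ArcList} (h : P.Perm Q) : comps P = comps Q :=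
  comps_eq_of_conn (fun _ => (h.flatMap_right _).mem_iff) (fun _ _ hxy => .of_mem (h.mem_iff.1 hxy))
    (fun _ _ hxy => .of_mem (h.mem_iff.2 hxy))

theorem comps_flip (a b : ℕ) (P : ArcList) : comps ((a, b) :: P) = comps ((b, a) :: P) := by
  refine comps_eq_of_conn (fun x => ?_) (fun x y h => ?_) (fun x y h => ?_)
  · simp only [ends_cons, List.mem_cons]
    tauto
  all_goals
    simp only [List.mem_cons, Prod.mk.injEq] at h
    rcases h with ⟨rfl, rfl⟩ | h
    · exact (Conn.of_mem (by simp)).symm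
    · exact Conn.of_mem (by simp [h])

/-- A point at which exactly two arcs meet may be erased. -/
theorem comps_contract {a b x : ℕ} {P : ArcList} (ha : x ≠ a) (hb : x ≠ b) (hP : x ∉ ends P) :
    comps ((a, x) :: (x, b) :: P) = comps ((a, b) :: P) := by
  have hne : ∀ y ∈ ends ((a, b) :: P), y ≠ x := by
    rintro y hy rfl
    simp [ha, hb, hP] at hy
  refine comps_congr (fun y => if y = x then a else y) id ?_ ?_ ?_ ?_ ?_ ?_
  · intro y hy
    simp only [ends_cons, List.mem_cons] at hy ⊢
    split_ifs <;> tauto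
  · intro y hy
    simp only [ends_cons, List.mem_cons, id] at hy ⊢
    tauto
  · intro y z h
    simp only [List.mem_cons, Prod.mk.injEq] at h
    rcases h with ⟨rfl, rfl⟩ | ⟨rfl, rfl⟩ | h
    · simpa [ha.symm] using Conn.refl _
    · simpa [hb.symm] using Conn.of_mem (by simp)
    · have hy : y ≠ x := fun e => hP (e ▸ mem_ends_left h)
      have hz : z ≠ x := fun e => hP (e ▸ mem_ends_right h)
      simpa [hy, hz] using Conn.of_mem (by simp [h])
  · intro y z h
    simp only [List.mem_cons, Prod.mk.injEq] at h
    rcases h with ⟨rfl, rfl⟩ | h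
    · exact (Conn.of_mem (y := x) (by simp)).trans (.of_mem (by simp))
    · exact Conn.of_mem (by simp [h])
  · intro y _
    dsimp only [id]
    split_ifs with h
    · subst h
      exact .of_mem (by simp)
    · exact .refl _
  · intro y hy
    simpa [hne y hy] using Conn.refl _

theorem comps_loop {x : ℕ} {P : ArcList} (hP : x ∉ ends P) : comps ((x, x) :: P) = comps P + 1 := by
  classical
  rw [comps, comps, ← Finite.card_option]
  have hx : x ∈ ends ((x, x) :: P) := by simp
  have hmem : ∀ e, e ∈ ends P → e ∈ ends ((x, x) :: P) := fun e he => by simp [he]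
  refine Nat.card_congr ⟨Quot.lift (fun e => if h : e.1 ∈ ends P then some (Quot.mk _ ⟨e.1, h⟩) else none) ?_,
    fun o => o.elim (Quot.mk _ ⟨x, hx⟩) (Quot.lift (fun e => Quot.mk _ ⟨e.1, hmem _ e.2⟩) ?_), ?_, ?_⟩
  · rintro ⟨y, hy⟩ ⟨z, hz⟩ h
    simp only [List.mem_cons, Prod.mk.injEq] at h
    rcases h with ⟨rfl, rfl⟩ | h
    · rfl
    · simp only [mem_ends_left h, mem_ends_right h, dif_pos]
      exact congrArg some (Quot.sound h)
  · rintro ⟨y, hy⟩ ⟨z, hz⟩ h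
    exact Quot.sound (List.mem_cons_of_mem _ h)
  · rintro ⟨y, hy⟩
    by_cases h : y ∈ ends P
    · simp [h]
    · have : y = x := by simpa [h] using hy
      subst this
      simp [h]
  · rintro (_ | ⟨⟨y, hy⟩⟩)
    · simp [hP]
    · simp [hy]

theorem comps_pos {p : ℕ × ℕ} {P : ArcList} : 0 < comps (p :: P) :=
  haveI : Nonempty (Quot fun x y : {e // e ∈ ends (p :: P)} => (x.1, y.1) ∈ p :: P) :=
    ⟨Quot.mk _ ⟨p.1, by simp⟩⟩
  Nat.card_pos

theorem comps_le_of_conn {P Q : ArcList} (h : ∀ x, x ∈ ends P ↔ x ∈ ends Q)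
    (hQP : ∀ x y, (x, y) ∈ Q → Conn P x y) : comps P ≤ comps Q :=
  Nat.card_le_card_of_surjective
    (Quot.lift (fun x => Quot.mk _ ⟨x.1, (h _).2 x.2⟩)
      fun x y hxy => Quot.eqvGen_sound ((hQP _ _ hxy).eqvGen_subtype _ _))
    (by rintro ⟨x, hx⟩; exact ⟨Quot.mk _ ⟨x, (h _).1 hx⟩, rfl⟩)

theorem comps_le_cons {a b : ℕ} {P : ArcList} (ha : a ∈ ends P) (hb : b ∈ ends P) :
    comps P ≤ comps ((a, b) :: P) + 1 := by
  have hmem : ∀ x, x ∈ ends P ↔ x ∈ ends ((a, b) :: P) := by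
    intro x
    simp only [ends_cons, List.mem_cons]
    grind
  refine (card_quot_le_succ (r' := fun x y => (x.1, y.1) ∈ (a, b) :: P)
    ⟨a, ha⟩ ⟨b, hb⟩ ?_ ?_).trans (le_of_eq ?_)
  · rintro ⟨x, hx⟩ ⟨y, hy⟩ h
    rcases List.mem_cons.1 h with h | h
    · simp only [Prod.mk.injEq] at h
      exact .inr ⟨Subtype.ext h.1, Subtype.ext h.2⟩
    · exact .inl h
  · exact fun x y h => List.mem_cons_of_mem _ h
  · rw [Nat.add_right_cancel_iff]
    exact card_quot_congr (fun x => ⟨x.1, (hmem _).1 x.2⟩) (fun x => ⟨x.1, (hmem _).2 x.2⟩)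
      (fun x y h => .rel _ _ h) (fun x y h => .rel _ _ h) (fun x => .refl _) (fun x => .refl _)

/-- Adding the arc `(a, d)` on the left loses at most one component. Afterwards `a, b, c, d` are all
connected, so every arc of the right-hand side already lies within one component. -/
theorem comps_reconnect_le (a b c d : ℕ) (P : ArcList) :
    comps ((a, b) :: (c, d) :: P) ≤ comps ((a, d) :: (c, b) :: P) + 1 := by
  refine (comps_le_cons (a := a) (b := d) (by simp) (by simp)).trans (Nat.add_le_add_right ?_ 1)
  refine comps_le_of_conn (fun x => ?_) fun x y h => ?_
  · simp only [ends_cons, List.mem_cons]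
    tauto
  · simp only [List.mem_cons, Prod.mk.injEq] at h
    rcases h with ⟨rfl, rfl⟩ | ⟨rfl, rfl⟩ | h
    · exact .of_mem (by simp)
    · exact ((Conn.of_mem (y := d) (by simp)).trans (Conn.of_mem (x := a) (by simp)).symm).trans
        (.of_mem (by simp))
    · exact .of_mem (by simp [h])

end ArcList

/-! ### Directed arcs and the three ways of closing up a tangle. -/

namespace ArcList

theorem mem_ends_iff {P : ArcList} {x : ℕ} : x ∈ ends P ↔ x ∈ P.map Prod.fst ∨ x ∈ P.map Prod.snd := by
  simp only [ends, List.mem_flatMap, List.mem_map, List.mem_cons, List.not_mem_nil, or_false]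
  constructor
  · rintro ⟨p, hp, rfl | rfl⟩
    · exact .inl ⟨p, hp, rfl⟩
    · exact .inr ⟨p, hp, rfl⟩
  · rintro (⟨p, hp, rfl⟩ | ⟨p, hp, rfl⟩)
    · exact ⟨p, hp, .inl rfl⟩
    · exact ⟨p, hp, .inr rfl⟩

theorem comps_contract_of_perm {a b x : ℕ} {P R : ArcList} (h : R.Perm ((a, x) :: (x, b) :: P)) (ha : x ≠ a)
    (hb : x ≠ b) (hP : x ∉ ends P) : comps R = comps ((a, b) :: P) :=
  (comps_perm h).trans (comps_contract ha hb hP)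

theorem comps_loop_of_perm {x : ℕ} {P R : ArcList} (h : R.Perm ((x, x) :: P)) (hP : x ∉ ends P) :
    comps R = comps P + 1 :=
  (comps_perm h).trans (comps_loop hP)

/-- The numbers of components that arise by joining four points `a, b, c, d` in the three possible
ways, when all arcs are directed and `a`, `c` are starting points, `b`, `d` are final points. -/
theorem comps_directed_tangle (n : ℕ) : ∀ (a b c d : ℕ) (Q : ArcList), Q.length = n →
    (a :: c :: Q.map Prod.fst).Nodup → (a :: c :: Q.map Prod.fst).Perm (b :: d :: Q.map Prod.snd) →
    ∃ k, (comps ((a, b) :: (c, d) :: Q) = k + 2 ∧ comps ((b, c) :: (d, a) :: Q) = k + 1 ∨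
      comps ((a, b) :: (c, d) :: Q) = k + 1 ∧ comps ((b, c) :: (d, a) :: Q) = k + 2) ∧
      comps ((a, c) :: (b, d) :: Q) = k + 1 := by
  -- Contracting arcs turns `Q` into directed paths from `b` and `d` to `a` and `c`, in one order or
  -- the other, together with closed curves. The two orders give the two alternatives. Since no path
  -- joins `a` to `c`, the closure by `(a, c)` and `(b, d)` is always connected, apart from the
  -- closed curves.
  induction n with
  | zero =>
    intro a b c d Q hQ hI hO
    obtain rfl := List.length_eq_zero_iff.1 hQ
    have hnil : comps [] = 0 := by
      have : IsEmpty (Quot fun x y : {e // e ∈ ends []} => (x.1, y.1) ∈ ([] : ArcList)) :=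
        ⟨by rintro ⟨x, hx⟩; simp at hx⟩
      exact Nat.card_of_isEmpty
    have hac : a ≠ c := by simpa using hI
    have h1 : ∀ x, comps [(x, x)] = 1 := fun x => by rw [comps_loop (by simp), hnil]
    have h2 : ∀ x y, x ≠ y → comps [(x, x), (y, y)] = 2 := fun x y hxy => by
      rw [comps_loop (by simpa using hxy), h1]
    have h3 : comps [(a, c), (c, a)] = 1 := by
      rw [comps_contract hac.symm hac.symm (by simp), h1]
    have h5 : comps [(a, c), (a, c)] = 1 := by
      rw [comps_flip, comps_contract hac hac (by simp), h1]
    have hb : b = a ∨ b = c := by simpa using (hO.mem_iff (a := b)).2 (by simp)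
    have hd : d = a ∨ d = c := by simpa using (hO.mem_iff (a := d)).2 (by simp)
    have hbd : b ≠ d := by simpa using hO.nodup_iff.1 hI
    refine ⟨0, ?_⟩
    rcases hb with rfl | rfl <;> rcases hd with rfl | rfl
    · exact absurd rfl hbd
    · exact ⟨.inl ⟨h2 _ _ hac, h3⟩, h5⟩
    · exact ⟨.inr ⟨h3, h2 _ _ hac.symm⟩, h3⟩
    · exact absurd rfl hbd
  | succ n ih =>
    intro a b c d Q hQ hI hO
    obtain _ | ⟨⟨x, y⟩, Q⟩ := Q
    · simp at hQ
    simp only [List.length_cons, Nat.add_right_cancel_iff] at hQ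
    have hO' := hO.nodup_iff.1 hI
    simp only [List.map_cons] at hI hO hO'
    -- A loop is a component of its own in all three closures and raises every count by one.
    by_cases hxy : x = y
    · subst hxy
      have hIc := hI
      simp only [List.nodup_cons, List.mem_cons, not_or] at hIc hO'
      obtain ⟨⟨hac, hax, haQ⟩, ⟨hcx, hcQ⟩, hxQ, -⟩ := hIc
      obtain ⟨⟨hbd, hbx, hbQ⟩, ⟨hdx, hdQ⟩, hxQ', -⟩ := hO'
      have hx : x ∉ ends Q := by rw [mem_ends_iff]; tauto
      have hxI : (a :: c :: Q.map Prod.fst).Nodup :=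
        hI.sublist (((List.sublist_cons_self _ _).cons_cons _).cons_cons _)
      have hxO : (a :: c :: Q.map Prod.fst).Perm (b :: d :: Q.map Prod.snd) := by
        rw [List.perm_iff_count] at hO ⊢
        intro e
        have := hO e
        simp only [List.count_cons] at this ⊢
        omega
      obtain ⟨k, hk⟩ := ih a b c d Q hQ hxI hxO
      have key : ∀ p q : ℕ × ℕ, p.1 ≠ x → p.2 ≠ x → q.1 ≠ x → q.2 ≠ x →
          comps (p :: q :: (x, x) :: Q) = comps (p :: q :: Q) + 1 := by
        rintro ⟨p1, p2⟩ ⟨q1, q2⟩ h1 h2 h3 h4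
        refine comps_loop_of_perm (x := x) ?_ ?_
        · rw [List.perm_iff_count]; intro e; simp only [List.count_cons]; ring
        · simp [hx, Ne.symm h1, Ne.symm h2, Ne.symm h3, Ne.symm h4]
      rw [key _ _ hax hbx hcx hdx, key _ _ hbx hcx hdx hax, key _ _ hax hcx hbx hdx]
      refine ⟨k + 1, ?_⟩
      omega
    · have hIc := hI
      have hOc := hO'
      simp only [List.nodup_cons, List.mem_cons, not_or] at hIc hOc
      obtain ⟨⟨hac, hax, haQ⟩, ⟨hcx, hcQ⟩, hxQ, hQ1⟩ := hIc
      obtain ⟨⟨hbd, hby, hbQ⟩, ⟨hdy, hdQ⟩, hyQ, hQ2⟩ := hOc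
      -- The starting point `x` is also a final point exactly once: as `b`, as `d`, or as the end of
      -- another arc of `Q`. In each case exactly two arcs meet at `x`, and `x` can be erased.
      have hxO : x ∈ b :: d :: y :: Q.map Prod.snd := hO.mem_iff.1 (by simp)
      simp only [List.mem_cons, hxy, false_or] at hxO
      rcases hxO with rfl | rfl | hxm
      · have hx : x ∉ ends Q := by rw [mem_ends_iff]; tauto
        obtain ⟨k, hk⟩ := ih a y c d Q hQ (hI.sublist (((List.sublist_cons_self _ _).cons_cons _).cons_cons _))
          (by
            rw [List.perm_iff_count] at hO ⊢
            intro e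
            have := hO e
            simp only [List.count_cons] at this ⊢
            omega)
        refine ⟨k, ?_⟩
        have e1 : comps ((a, x) :: (c, d) :: (x, y) :: Q) = comps ((a, y) :: (c, d) :: Q) := by
          refine comps_contract_of_perm (x := x) (P := (c, d) :: Q) ?_ (Ne.symm hax) hxy (by
            simp [Ne.symm hcx, hbd, hx])
          rw [List.perm_iff_count]; intro e; simp only [List.count_cons]; ring
        have e2 : comps ((x, c) :: (d, a) :: (x, y) :: Q) = comps ((y, c) :: (d, a) :: Q) := by
          rw [comps_flip, comps_flip y]
          refine comps_contract_of_perm (x := x) (P := (d, a) :: Q) ?_ (Ne.symm hcx) hxy (by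
            simp [Ne.symm hax, hbd, hx])
          rw [List.perm_iff_count]; intro e; simp only [List.count_cons]; ring
        have e3 : comps ((a, c) :: (x, d) :: (x, y) :: Q) = comps ((a, c) :: (y, d) :: Q) := by
          have s1 : comps ((a, c) :: (x, d) :: (x, y) :: Q) = comps ((d, x) :: (x, y) :: (a, c) :: Q) := by
            rw [comps_flip d]
            refine comps_perm ?_
            rw [List.perm_iff_count]; intro e; simp only [List.count_cons]; ring
          rw [s1, comps_contract hbd hxy (by simp [Ne.symm hax, Ne.symm hcx, hx]), comps_flip]
          exact comps_perm (List.Perm.swap _ _ _)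
        rwa [e1, e2, e3]
      · have hx : x ∉ ends Q := by rw [mem_ends_iff]; tauto
        obtain ⟨k, hk⟩ := ih a b c y Q hQ (hI.sublist (((List.sublist_cons_self _ _).cons_cons _).cons_cons _))
          (by
            rw [List.perm_iff_count] at hO ⊢
            intro e
            have := hO e
            simp only [List.count_cons] at this ⊢
            omega)
        refine ⟨k, ?_⟩
        have key : ∀ (p : ℕ × ℕ) (e : ℕ), p.1 ≠ x → p.2 ≠ x → e ≠ x →
            comps (p :: (e, x) :: (x, y) :: Q) = comps (p :: (e, y) :: Q) := by
          rintro ⟨p1, p2⟩ e h1 h2 h3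
          refine (comps_contract_of_perm (x := x) (P := (p1, p2) :: Q) ?_ (Ne.symm h3) hxy
            (by simp [Ne.symm h1, Ne.symm h2, hx])).trans (comps_perm (List.Perm.swap _ _ _))
          rw [List.perm_iff_count]; intro e; simp only [List.count_cons]; ring
        have key' : ∀ (p : ℕ × ℕ) (e : ℕ), p.1 ≠ x → p.2 ≠ x → e ≠ x →
            comps (p :: (x, e) :: (x, y) :: Q) = comps (p :: (y, e) :: Q) := by
          intro p e h1 h2 h3
          rw [comps_perm (List.Perm.swap _ _ _), comps_flip, comps_perm (List.Perm.swap _ _ _), key p e h1 h2 h3,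
            comps_perm (List.Perm.swap _ _ _), comps_flip, comps_perm (List.Perm.swap _ _ _)]
        rwa [key _ _ hax hbd hcx, key' _ _ hbd hcx hax, key _ _ hax hcx hbd]
      · obtain ⟨⟨z, x'⟩, hz, rfl⟩ := List.mem_map.1 hxm
        dsimp only at *
        obtain ⟨R, hR⟩ : ∃ R, Q.Perm ((z, x') :: R) := ⟨_, List.perm_cons_erase hz⟩
        have hR1 := hR.map Prod.fst
        have hR2 := hR.map Prod.snd
        simp only [List.map_cons] at hR1 hR2
        have hQ1' := hR1.nodup_iff.1 hQ1
        have hQ2' := hR2.nodup_iff.1 hQ2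
        simp only [List.nodup_cons] at hQ1' hQ2'
        have hxz : x' ≠ z := by
          rintro rfl
          exact hxQ (hR1.mem_iff.2 (by simp))
        have hxR : x' ∉ ends R := by
          rw [mem_ends_iff]
          rintro (h | h)
          · exact hxQ (hR1.mem_iff.2 (by simp [h]))
          · exact hQ2'.1 h
        have hxb : b ≠ x' := by rintro rfl; exact hbQ hxm
        have hxd : d ≠ x' := by rintro rfl; exact hdQ hxm
        have hlen : ((z, y) :: R).length = n := by rw [← hQ, hR.length_eq]; rfl
        obtain ⟨k, hk⟩ := ih a b c d ((z, y) :: R) hlen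
          (by
            refine (List.Perm.nodup_iff ?_).1
              (hI.sublist (((List.sublist_cons_self _ _).cons_cons _).cons_cons _))
            exact (hR1.cons _).cons _)
          (by
            rw [List.perm_iff_count] at hO hR1 hR2 ⊢
            intro e
            have h1 := hO e
            have h2 := hR1 e
            have h3 := hR2 e
            simp only [List.count_cons, List.map_cons] at h1 h2 h3 ⊢
            omega)
        have key : ∀ p q : ℕ × ℕ, p.1 ≠ x' → p.2 ≠ x' → q.1 ≠ x' → q.2 ≠ x' →
            comps (p :: q :: (x', y) :: Q) = comps (p :: q :: (z, y) :: R) := by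
          rintro ⟨p1, p2⟩ ⟨q1, q2⟩ h1 h2 h3 h4
          refine (comps_contract_of_perm (x := x') (a := z) (b := y) (P := (p1, p2) :: (q1, q2) :: R) ?_ hxz hxy
            (by simp [Ne.symm h1, Ne.symm h2, Ne.symm h3, Ne.symm h4, hxR])).trans (comps_perm ?_)
          · refine (((hR.cons _).cons _).cons _).trans ?_
            rw [List.perm_iff_count]; intro e; simp only [List.count_cons]; ring
          · rw [List.perm_iff_count]; intro e; simp only [List.count_cons]; ring
        refine ⟨k, ?_⟩
        rwa [key _ _ hax hxb hcx hxd, key _ _ hxb hcx hxd hax, key _ _ hax hcx hxb hxd]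

end ArcList

/-! ### Splices of single vertices. -/

/-- The other way of splicing. -/
def Splice.other : Splice → Splice
  | A => B
  | B => A

namespace DiagramNode

/-- The splice of a vertex of the given type. -/
def spliceBy : Splice → DiagramNode → List DiagramNode
  | .A, n => n.spliceA
  | .B, n => n.spliceB

theorem spliceBy_of_not_isReal {n : DiagramNode} (h : ¬ n.IsReal) (X : Splice) : n.spliceBy X = [n] := by
  rcases n with ⟨_ | _ | _, a, b, c, d⟩ | ⟨a, b⟩ <;> cases X <;> simp_all [IsReal, spliceBy, spliceA, spliceB]

theorem not_isReal_of_mem_spliceBy {n m : DiagramNode} {X : Splice} (h : m ∈ n.spliceBy X) : ¬ m.IsReal := by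
  rcases n with ⟨_ | _ | _, a, b, c, d⟩ | ⟨a, b⟩ <;> cases X <;>
    simp only [spliceBy, spliceA, spliceB, List.mem_cons, List.not_mem_nil, or_false] at h <;>
    rcases h with rfl | rfl <;> simp [IsReal]

theorem ends_spliceBy_perm (X : Splice) (n : DiagramNode) : ((n.spliceBy X).flatMap ends).Perm n.ends := by
  rw [List.perm_iff_count]
  intro e
  rcases n with ⟨_ | _ | _, a, b, c, d⟩ | ⟨a, b⟩ <;> cases X <;>
    simp only [spliceBy, spliceA, spliceB, ends, List.flatMap_cons, List.flatMap_nil, List.append_nil,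
      List.cons_append, List.nil_append, List.count_cons, List.count_nil] <;> ring

end DiagramNode

/-! ### Components of codes and alternating orientations. -/

namespace PDCode

open DiagramNode ArcList

/-- The arcs into which the strands are cut by the vertices. -/
def arcs (C : PDCode) : ArcList := C.flatMap strands

@[simp] theorem arcs_nil : arcs [] = [] := rfl

@[simp] theorem arcs_cons (n : DiagramNode) (C : PDCode) : arcs (n :: C) = n.strands ++ arcs C := rfl

@[simp] theorem arcs_append (C E : PDCode) : arcs (C ++ E) = arcs C ++ arcs E := List.flatMap_append

theorem mem_ends_arcs {C : PDCode} {e : ℕ} : e ∈ ArcList.ends (arcs C) ↔ e ∈ allEnds C := by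
  simp only [ArcList.ends, arcs, allEnds, List.flatMap_assoc, List.mem_flatMap]
  refine exists_congr fun n => and_congr_right fun _ => ?_
  rcases n with ⟨k, a, b, c, d⟩ | ⟨a, b⟩ <;> simp [strands, DiagramNode.ends]
  tauto

theorem numComponents_eq_comps (C : PDCode) : numComponents C = comps (arcs C) := by
  refine Nat.card_congr (Quot.congr (Equiv.subtypeEquivRight fun e => mem_ends_arcs.symm) ?_)
  intro x y
  simp only [arcs, List.mem_flatMap]
  exact Iff.rfl

theorem numComponents_perm {C E : PDCode} (h : C.Perm E) : numComponents C = numComponents E := by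
  rw [numComponents_eq_comps, numComponents_eq_comps]
  exact comps_perm (h.flatMap_right _)

/-- The two splices of a crossing differ by a reconnection of two arcs. No orientation is needed, so
the bound also holds in the presence of virtual crossings. -/
theorem numComponents_splice_le (X : Splice) (n : DiagramNode) (C : PDCode) :
    numComponents (n.spliceBy X ++ C) ≤ numComponents (n.spliceBy X.other ++ C) + 1 := by
  have key : ∀ a b c d, comps ((b, c) :: (d, a) :: arcs C) ≤ comps ((a, b) :: (c, d) :: arcs C) + 1 := by
    intro a b c d
    refine (comps_reconnect_le b c d a _).trans (le_of_eq ?_)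
    rw [comps_flip, comps_perm (List.Perm.swap _ _ _), comps_flip, comps_perm (List.Perm.swap _ _ _)]
  have key' : ∀ a b c d, comps ((a, b) :: (c, d) :: arcs C) ≤ comps ((b, c) :: (d, a) :: arcs C) + 1 := by
    intro a b c d
    refine (comps_reconnect_le a b c d _).trans (le_of_eq ?_)
    rw [comps_flip, comps_perm (List.Perm.swap _ _ _), comps_flip]
  simp only [numComponents_eq_comps]
  rcases n with ⟨_ | _ | _, a, b, c, d⟩ | ⟨a, b⟩ <;> cases X <;>
    simp [Splice.other, spliceBy, spliceA, spliceB, strands, key, key']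

/-- An orientation of the edges for which the four edge ends at each crossing are alternately
incoming and outgoing; `I` lists the incoming and `O` the outgoing edge ends of all vertices. -/
inductive Flow : PDCode → List ℕ → List ℕ → Prop
  | nil : Flow [] [] []
  | crossing {C I O} (k : CrossingKind) (hk : k ≠ .virt) (a b c d : ℕ) :
      Flow C I O → Flow (crossing k a b c d :: C) (a :: c :: I) (b :: d :: O)
  | crossing_reverse {C I O} (k : CrossingKind) (hk : k ≠ .virt) (a b c d : ℕ) :
      Flow C I O → Flow (crossing k a b c d :: C) (b :: d :: I) (a :: c :: O)
  | join {C I O} (a b : ℕ) : Flow C I O → Flow (join a b :: C) (a :: I) (b :: O)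
  | join_reverse {C I O} (a b : ℕ) : Flow C I O → Flow (join a b :: C) (b :: I) (a :: O)

/-- The code has an alternating orientation of its edges. -/
def SourceSink (C : PDCode) : Prop := ∃ I O, Flow C I O ∧ I.Nodup ∧ I.Perm O

/-- The contribution of the first vertex does not depend on the others; this is what lets vertices
be reordered in `Flow.perm`. -/
theorem Flow.cons_cons {n : DiagramNode} {C : PDCode} {I O : List ℕ} (h : Flow (n :: C) I O) :
    ∃ i o I₁ O₁, I = i ++ I₁ ∧ O = o ++ O₁ ∧ Flow C I₁ O₁ ∧ ∀ E I₂ O₂, Flow E I₂ O₂ →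
      Flow (n :: E) (i ++ I₂) (o ++ O₂) := by
  cases h with
  | crossing k hk a b c d h => exact ⟨[a, c], [b, d], _, _, rfl, rfl, h, fun _ _ _ h => .crossing k hk a b c d h⟩
  | crossing_reverse k hk a b c d h =>
    exact ⟨[b, d], [a, c], _, _, rfl, rfl, h, fun _ _ _ h => .crossing_reverse k hk a b c d h⟩
  | join a b h => exact ⟨[a], [b], _, _, rfl, rfl, h, fun _ _ _ h => .join a b h⟩
  | join_reverse a b h => exact ⟨[b], [a], _, _, rfl, rfl, h, fun _ _ _ h => .join_reverse a b h⟩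

theorem Flow.perm {C E : PDCode} (h : C.Perm E) : ∀ {I O}, Flow C I O →
    ∃ I' O', Flow E I' O' ∧ I.Perm I' ∧ O.Perm O' := by
  induction h with
  | nil => exact fun h => ⟨_, _, h, .refl _, .refl _⟩
  | cons n _ ih =>
    intro I O h
    obtain ⟨i, o, I₁, O₁, rfl, rfl, h1, h2⟩ := h.cons_cons
    obtain ⟨I', O', h', hI, hO⟩ := ih h1
    exact ⟨_, _, h2 _ _ _ h', hI.append_left _, hO.append_left _⟩
  | swap n m C =>
    intro I O h
    obtain ⟨i, o, I₁, O₁, rfl, rfl, h1, h2⟩ := h.cons_cons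
    obtain ⟨i', o', I₂, O₂, rfl, rfl, h1', h2'⟩ := h1.cons_cons
    exact ⟨_, _, h2' _ _ _ (h2 _ _ _ h1'), List.perm_append_comm_assoc _ _ _, List.perm_append_comm_assoc _ _ _⟩
  | trans _ _ ih ih' =>
    intro I O h
    obtain ⟨I', O', h', hI, hO⟩ := ih h
    obtain ⟨I'', O'', h'', hI', hO'⟩ := ih' h'
    exact ⟨_, _, h'', hI.trans hI', hO.trans hO'⟩

theorem SourceSink.perm {C E : PDCode} (h : C.Perm E) (hC : SourceSink C) : SourceSink E := by
  obtain ⟨I, O, h1, h2, h3⟩ := hC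
  obtain ⟨I', O', h', hI, hO⟩ := h1.perm h
  exact ⟨I', O', h', hI.nodup_iff.1 h2, hI.symm.trans (h3.trans hO)⟩

/-- Each splice joins neighbouring ends of the crossing, and neighbours have opposite directions, so
both splices inherit the orientation. -/
theorem Flow.splice {n : DiagramNode} {C : PDCode} {I O : List ℕ} (h : Flow (n :: C) I O) (X : Splice) :
    ∃ I' O', Flow (n.spliceBy X ++ C) I' O' ∧ I.Perm I' ∧ O.Perm O' := by
  cases h with
  | crossing k hk a b c d h =>
    cases k <;> cases X <;> first
      | exact absurd rfl hk
      | exact ⟨_, _, .join_reverse b c (.join_reverse d a h), .swap _ _ _, .refl _⟩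
      | exact ⟨_, _, .join a b (.join c d h), .refl _, .refl _⟩
  | crossing_reverse k hk a b c d h =>
    cases k <;> cases X <;> first
      | exact absurd rfl hk
      | exact ⟨_, _, .join b c (.join d a h), .refl _, .swap _ _ _⟩
      | exact ⟨_, _, .join_reverse a b (.join_reverse c d h), .refl _, .refl _⟩
  | join a b h => cases X <;> exact ⟨_, _, .join a b h, .refl _, .refl _⟩
  | join_reverse a b h => cases X <;> exact ⟨_, _, .join_reverse a b h, .refl _, .refl _⟩

theorem SourceSink.splice {n : DiagramNode} {C : PDCode} (h : SourceSink (n :: C)) (X : Splice) :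
    SourceSink (n.spliceBy X ++ C) := by
  obtain ⟨I, O, h1, h2, h3⟩ := h
  obtain ⟨I', O', h', hI, hO⟩ := h1.splice X
  exact ⟨I', O', h', hI.nodup_iff.1 h2, hI.symm.trans (h3.trans hO)⟩

/-- A code without crossings is turned into directed arcs. -/
theorem Flow.exists_directed {C : PDCode} {I O : List ℕ} (h : Flow C I O) (hC : ∀ n ∈ C, ¬ n.IsReal) :
    ∃ Q : ArcList, Q.map Prod.fst = I ∧ Q.map Prod.snd = O ∧
      ∀ P : ArcList, comps (P ++ arcs C) = comps (P ++ Q) := by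
  -- The arbitrary prefix `P` absorbs the arcs that the induction has already passed.
  induction h with
  | nil => exact ⟨[], rfl, rfl, fun P => rfl⟩
  | crossing k hk a b c d h ih => exact absurd hk (hC (.crossing k a b c d) (by simp))
  | crossing_reverse k hk a b c d h ih => exact absurd hk (hC (.crossing k a b c d) (by simp))
  | join a b h ih =>
    obtain ⟨Q, rfl, rfl, hQ⟩ := ih fun n hn => hC n (by simp [hn])
    refine ⟨(a, b) :: Q, rfl, rfl, fun P => ?_⟩
    simpa [strands] using hQ (P ++ [(a, b)])
  | join_reverse a b h ih =>
    obtain ⟨Q, rfl, rfl, hQ⟩ := ih fun n hn => hC n (by simp [hn])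
    refine ⟨(b, a) :: Q, rfl, rfl, fun P => ?_⟩
    have := hQ (P ++ [(a, b)])
    simp only [List.append_assoc, List.cons_append, List.nil_append] at this
    rw [comps_perm List.perm_middle, comps_flip, comps_perm List.perm_middle.symm, ← this]
    simp [strands]

/-- In an alternatingly oriented code whose only crossing is `n`, the two splices of `n` differ by
one component, and making `n` virtual leads to the smaller of the two numbers. -/
theorem SourceSink.tangle {n : DiagramNode} {C : PDCode} (h : SourceSink (n :: C)) (hn : n.IsReal)
    (hC : ∀ m ∈ C, ¬ m.IsReal) (X : Splice) :
    ∃ k, (numComponents (n.spliceBy X ++ C) = k + 2 ∧ numComponents (n.spliceBy X.other ++ C) = k + 1 ∨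
      numComponents (n.spliceBy X ++ C) = k + 1 ∧ numComponents (n.spliceBy X.other ++ C) = k + 2) ∧
      numComponents (n.virtualize :: C) = k + 1 := by
  have main : ∃ k, (numComponents (n.spliceBy .A ++ C) = k + 2 ∧ numComponents (n.spliceBy .B ++ C) = k + 1 ∨
      numComponents (n.spliceBy .A ++ C) = k + 1 ∧ numComponents (n.spliceBy .B ++ C) = k + 2) ∧
      numComponents (n.virtualize :: C) = k + 1 := by
    obtain ⟨I, O, h1, h2, h3⟩ := h
    simp only [numComponents_eq_comps]
    cases h1 with
    | crossing k hk a b c d h =>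
      obtain ⟨Q, rfl, rfl, hQ⟩ := h.exists_directed hC
      have hQ2 : ∀ p q, comps (p :: q :: arcs C) = comps (p :: q :: Q) := fun p q => hQ [p, q]
      obtain ⟨m, h4, h5⟩ := comps_directed_tangle _ a b c d Q rfl h2 h3
      simp only [← hQ2] at h4 h5
      refine ⟨m, ?_, h5⟩
      cases k
      · exact h4.symm.imp And.symm And.symm
      · exact h4
      · exact absurd rfl hk
    | crossing_reverse k hk a b c d h =>
      obtain ⟨Q, rfl, rfl, hQ⟩ := h.exists_directed hC
      have hQ2 : ∀ p q, comps (p :: q :: arcs C) = comps (p :: q :: Q) := fun p q => hQ [p, q]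
      -- Now `b` and `d` are the starting points, so the four points are read from `b` on and the
      -- two splices exchange their roles.
      obtain ⟨m, h4, h5⟩ := comps_directed_tangle _ b c d a Q rfl h2 (h3.trans (.swap _ _ _))
      have e1 : comps ((c, d) :: (a, b) :: Q) = comps ((a, b) :: (c, d) :: Q) :=
        comps_perm (.swap _ _ _)
      have e2 : comps ((b, d) :: (c, a) :: Q) = comps ((a, c) :: (b, d) :: Q) := by
        rw [comps_perm (.swap _ _ _), comps_flip]
      rw [e1] at h4
      rw [e2] at h5
      simp only [← hQ2] at h4 h5
      refine ⟨m, ?_, h5⟩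
      cases k
      · exact h4
      · exact h4.symm.imp And.symm And.symm
      · exact absurd rfl hk
    | join a b h => exact hn.elim
    | join_reverse a b h => exact hn.elim
  cases X
  · exact main
  · obtain ⟨k, h1, h2⟩ := main
    exact ⟨k, h1.symm.imp And.symm And.symm, h2⟩

end PDCode

/-! ### The bracket as an iterated skein relation. -/

namespace PDCode

open DiagramNode LaurentPolynomial

/-- The bracket, computed by splicing the crossings of the first code one after the other while the
second code is left as it is. The splice of type `X` has weight `T 1`, the other one `T (-1)`. -/
noncomputable def skein (X : Splice) : PDCode → PDCode → LaurentPolynomial ℤ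
  | [], L => (-T 2 - T (-2)) ^ (numComponents L - 1)
  | n :: C, L => if n.IsReal then
      T 1 * skein X C (n.spliceBy X ++ L) + T (-1) * skein X C (n.spliceBy X.other ++ L)
    else skein X C (n :: L)

theorem skein_nil (X : Splice) (L : PDCode) : skein X [] L = (-T 2 - T (-2)) ^ (numComponents L - 1) := rfl

theorem skein_cons_real (X : Splice) {n : DiagramNode} (hn : n.IsReal) (C L : PDCode) :
    skein X (n :: C) L =
      T 1 * skein X C (n.spliceBy X ++ L) + T (-1) * skein X C (n.spliceBy X.other ++ L) := if_pos hn

theorem skein_cons_not_real (X : Splice) {n : DiagramNode} (hn : ¬ n.IsReal) (C L : PDCode) :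
    skein X (n :: C) L = skein X C (n :: L) := if_neg hn

theorem skein_perm_right (X : Splice) (C : PDCode) : ∀ {L M : PDCode}, L.Perm M → skein X C L = skein X C M := by
  induction C with
  | nil =>
    intro L M h
    rw [skein_nil, skein_nil, numComponents_perm h]
  | cons n C ih =>
    intro L M h
    by_cases hn : n.IsReal
    · rw [skein_cons_real X hn, skein_cons_real X hn, ih (h.append_left _), ih (h.append_left _)]
    · rw [skein_cons_not_real X hn, skein_cons_not_real X hn, ih (h.cons _)]

/-- Splices at different vertices commute. Hence the vertices affected by a local move may be placed
last, after all others have been spliced. -/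
theorem skein_perm_left (X : Splice) {C E : PDCode} (h : C.Perm E) : ∀ L, skein X C L = skein X E L := by
  induction h with
  | nil => exact fun L => rfl
  | cons n _ ih =>
    intro L
    by_cases hn : n.IsReal
    · rw [skein_cons_real X hn, skein_cons_real X hn, ih, ih]
    · rw [skein_cons_not_real X hn, skein_cons_not_real X hn, ih]
  | swap n m C =>
    intro L
    have comm : ∀ A B : PDCode, skein X C (A ++ (B ++ L)) = skein X C (B ++ (A ++ L)) :=
      fun A B => skein_perm_right X C (List.perm_append_comm_assoc _ _ _)
    have comm₁ : ∀ (A : PDCode) (k : DiagramNode), skein X C (A ++ k :: L) = skein X C (k :: (A ++ L)) :=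
      fun A k => skein_perm_right X C List.perm_middle
    by_cases hn : n.IsReal <;> by_cases hm : m.IsReal
    · simp only [skein_cons_real X hn, skein_cons_real X hm]
      rw [comm (spliceBy X n), comm (spliceBy X n), comm (spliceBy X.other n), comm (spliceBy X.other n)]
      ring
    · simp only [skein_cons_real X hn, skein_cons_not_real X hm]
      rw [comm₁, comm₁]
    · simp only [skein_cons_real X hm, skein_cons_not_real X hn]
      rw [comm₁, comm₁]
    · simp only [skein_cons_not_real X hm, skein_cons_not_real X hn]
      exact comm [n] [m]
  | trans _ _ ih ih' => exact fun L => (ih L).trans (ih' L)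

/-- Exchanging the two splices replaces `A` by its inverse, and the loop value is symmetric. Bounds
for the minimal degree thus follow from bounds for the maximal one. -/
theorem skein_B_eq_invert (C : PDCode) : ∀ L, skein .B C L = invert (skein .A C L) := by
  induction C with
  | nil =>
    intro L
    simp only [skein_nil, map_pow, map_sub, map_neg, invert_T, neg_neg]
    congr 1
    ring
  | cons n C ih =>
    intro L
    by_cases hn : n.IsReal
    · simp only [skein_cons_real _ hn, ih, Splice.other, map_add, map_mul, invert_T, neg_neg]
      ring
    · rw [skein_cons_not_real _ hn, skein_cons_not_real _ hn, ih]

/-- Every edge has exactly two ends. -/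
def TwoEnds (C : PDCode) : Prop := ∀ e ∈ allEnds C, (allEnds C).count e = 2

@[simp] theorem allEnds_cons (n : DiagramNode) (C : PDCode) : allEnds (n :: C) = n.ends ++ allEnds C := rfl

@[simp] theorem allEnds_append (C E : PDCode) : allEnds (C ++ E) = allEnds C ++ allEnds E :=
  List.flatMap_append

theorem TwoEnds.of_perm {C E : PDCode} (h : TwoEnds C) (hp : (allEnds C).Perm (allEnds E)) : TwoEnds E := by
  intro e he
  rw [← hp.count_eq]
  exact h e (hp.mem_iff.2 he)

theorem TwoEnds.splice {l C : PDCode} {n : DiagramNode} (X : Splice) {L : PDCode}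
    (h : TwoEnds (l ++ (n :: C ++ L))) : TwoEnds (l ++ (C ++ (n.spliceBy X ++ L))) := by
  refine h.of_perm ?_
  have h1 : (allEnds (n.spliceBy X)).Perm n.ends := ends_spliceBy_perm X n
  rw [List.perm_iff_count] at h1 ⊢
  intro e
  have := h1 e
  simp only [allEnds_append, allEnds_cons, List.count_append]
  omega

/-- The vertices of `C` are spliced first and join the context, so the local identity is needed only
for arbitrary `L`. The two-ends conditions survive splicing; they later guarantee that the inner
edges of a move do not occur in the context. -/
theorem skein_congr (X : Splice) (u : LaurentPolynomial ℤ) {l r : PDCode}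
    (h : ∀ L, TwoEnds (l ++ L) → TwoEnds (r ++ L) → skein X l L = u * skein X r L) (C : PDCode) :
    ∀ L, TwoEnds (l ++ (C ++ L)) → TwoEnds (r ++ (C ++ L)) → skein X (C ++ l) L = u * skein X (C ++ r) L := by
  induction C with
  | nil => exact fun L hl hr => h L hl hr
  | cons n C ih =>
    intro L hl hr
    by_cases hn : n.IsReal
    · rw [List.cons_append, List.cons_append, skein_cons_real X hn, skein_cons_real X hn,
        ih _ (hl.splice X) (hr.splice X), ih _ (hl.splice X.other) (hr.splice X.other)]
      ring
    · have hl' := hl.splice X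
      have hr' := hr.splice X
      rw [spliceBy_of_not_isReal hn] at hl' hr'
      rw [List.cons_append, List.cons_append, skein_cons_not_real X hn, skein_cons_not_real X hn]
      exact ih _ hl' hr'

/-- The exponent `±1` with which a splice contributes to the weight. -/
def _root_.Splice.exponent : Splice → ℤ
  | .A => 1
  | .B => -1

theorem weight_eq (C : PDCode) (s : State C) :
    weight C s = T (∑ p, (s p).exponent) * (-T 2 - T (-2)) ^ (stateComponents C s - 1) := by
  rw [weight]
  congr 2
  rw [Finset.card_filter, Finset.card_filter]
  push_cast
  rw [← Finset.sum_sub_distrib]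
  refine Finset.sum_congr rfl fun p _ => ?_
  cases s p <;> simp [Splice.exponent]

theorem splice_cons_real {n : DiagramNode} {C : PDCode} (hn : n.IsReal) (s : State (n :: C)) :
    splice (n :: C) s = n.spliceBy (s ⟨0, hn⟩) ++ splice C fun p => s ⟨p.1.succ, p.2⟩ := by
  rw [splice, splice]
  change List.flatMap _ (List.finRange (C.length + 1)) = _
  rw [List.finRange_succ, List.flatMap_cons, List.flatMap_map]
  congr 1
  have h0 : ((n :: C).get 0).IsReal := hn
  rw [dif_pos h0]
  cases s ⟨0, hn⟩ <;> rfl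

theorem splice_cons_not_real {n : DiagramNode} {C : PDCode} (hn : ¬ n.IsReal) (s : State (n :: C)) :
    splice (n :: C) s = n :: splice C fun p => s ⟨p.1.succ, p.2⟩ := by
  rw [splice, splice]
  change List.flatMap _ (List.finRange (C.length + 1)) = _
  rw [List.finRange_succ, List.flatMap_cons, List.flatMap_map]
  have h0 : ¬ ((n :: C).get 0).IsReal := hn
  rw [dif_neg h0]
  rfl

theorem sum_realCrossing_cons_real {n : DiagramNode} {C : PDCode} (hn : n.IsReal)
    (f : RealCrossing (n :: C) → ℤ) :
    ∑ p, f p = f ⟨0, hn⟩ + ∑ p : RealCrossing C, f ⟨p.1.succ, p.2⟩ := by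
  refine Eq.trans ?_
    (Fintype.sum_option fun o : Option (RealCrossing C) => o.elim (f ⟨0, hn⟩) fun p => f ⟨p.1.succ, p.2⟩)
  symm
  refine Fintype.sum_bijective (fun o : Option (RealCrossing C) => o.elim ⟨0, hn⟩ fun p => ⟨p.1.succ, p.2⟩) ⟨?_, ?_⟩ _ _ ?_
  · rintro (_ | ⟨i, hi⟩) (_ | ⟨j, hj⟩) h
    · rfl
    · exact absurd (congrArg (fun p => p.1) h).symm (Fin.succ_ne_zero j)
    · exact absurd (congrArg (fun p => p.1) h) (Fin.succ_ne_zero i)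
    · have : i.succ = j.succ := congrArg (fun p => p.1) h
      simp [Fin.succ_inj.1 this]
  · rintro ⟨i, hi⟩
    obtain rfl | ⟨j, rfl⟩ := Fin.eq_zero_or_eq_succ i
    · exact ⟨none, rfl⟩
    · exact ⟨some ⟨j, hi⟩, rfl⟩
  · rintro (_ | p) <;> rfl

theorem bijective_succ_of_not_real {n : DiagramNode} {C : PDCode} (hn : ¬ n.IsReal) :
    Function.Bijective fun p : RealCrossing C => (⟨p.1.succ, p.2⟩ : RealCrossing (n :: C)) := by
  constructor
  · rintro ⟨i, hi⟩ ⟨j, hj⟩ h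
    have : i.succ = j.succ := congrArg (fun p => p.1) h
    simp [Fin.succ_inj.1 this]
  · rintro ⟨i, hi⟩
    obtain rfl | ⟨j, rfl⟩ := Fin.eq_zero_or_eq_succ i
    · exact absurd hi hn
    · exact ⟨⟨j, hi⟩, rfl⟩

/-- If the first vertex is real, a state is a choice there together with a state of the rest. The
context `L` is arbitrary because it receives the vertices already treated. -/
theorem sum_weight_eq_skein (C : PDCode) : ∀ L, ∑ s : State C, T (∑ p, (s p).exponent) *
    (-T 2 - T (-2) : LaurentPolynomial ℤ) ^ (numComponents (splice C s ++ L) - 1) = skein .A C L := by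
  induction C with
  | nil =>
    intro L
    have : IsEmpty (RealCrossing []) := ⟨fun p => p.1.elim0⟩
    simp [splice, skein_nil]
  | cons n C ih =>
    intro L
    by_cases hn : n.IsReal
    · rw [skein_cons_real _ hn, ← ih, ← ih, Finset.mul_sum, Finset.mul_sum]
      let G : Splice × State C → LaurentPolynomial ℤ := fun x => T x.1.exponent *
        (T (∑ p, (x.2 p).exponent) * (-T 2 - T (-2)) ^ (numComponents (splice C x.2 ++ (n.spliceBy x.1 ++ L)) - 1))
      have h2 : ∑ x, G x = ∑ t, G (.A, t) + ∑ t, G (.B, t) := by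
        rw [Fintype.sum_prod_type]
        exact Finset.sum_pair (by decide)
      refine Eq.trans ?_ h2
      refine Fintype.sum_bijective
        (fun s : State (n :: C) => (s ⟨0, hn⟩, fun p : RealCrossing C => s ⟨p.1.succ, p.2⟩)) ⟨?_, ?_⟩ _ _ ?_
      · intro s t h
        simp only [Prod.mk.injEq] at h
        funext ⟨i, hi⟩
        obtain rfl | ⟨j, rfl⟩ := Fin.eq_zero_or_eq_succ i
        · exact h.1
        · exact congrFun h.2 ⟨j, hi⟩
      · rintro ⟨x, t⟩
        exact ⟨fun p => Fin.cases (motive := fun i => ((n :: C).get i).IsReal → Splice)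
          (fun _ => x) (fun j hj => t ⟨j, hj⟩) p.1 p.2, rfl⟩
      · intro s
        have hp : (splice (n :: C) s ++ L).Perm
            (splice C (fun p => s ⟨p.1.succ, p.2⟩) ++ (n.spliceBy (s ⟨0, hn⟩) ++ L)) := by
          rw [splice_cons_real hn, List.append_assoc]
          exact List.perm_append_comm_assoc _ _ _
        rw [sum_realCrossing_cons_real hn, numComponents_perm hp, T_add, mul_assoc]
    · rw [skein_cons_not_real _ hn, ← ih]
      refine Fintype.sum_bijective (fun (s : State (n :: C)) (p : RealCrossing C) => s ⟨p.1.succ, p.2⟩)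
        (Function.Bijective.comp_right (bijective_succ_of_not_real hn)) _ _ ?_
      intro s
      have hp : (splice (n :: C) s ++ L).Perm (splice C (fun p => s ⟨p.1.succ, p.2⟩) ++ n :: L) := by
        rw [splice_cons_not_real hn]
        exact List.perm_middle.symm
      rw [numComponents_perm hp]
      congr 2
      exact (Fintype.sum_bijective _ (bijective_succ_of_not_real hn) _ _ fun _ => rfl).symm

theorem bracket_eq_skein (C : PDCode) : bracket C = skein .A C [] := by
  rw [← sum_weight_eq_skein, bracket]
  refine Finset.sum_congr rfl fun s _ => ?_
  rw [weight_eq, stateComponents, List.append_nil]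

end PDCode

/-! A decision procedure for local skein identities: arcs are listed with symbols as end points, and
points at which two arcs meet are erased symbolically. -/

namespace ArcList

/-- Rename the end points. -/
def rename (φ : ℕ → ℕ) (S : ArcList) : ArcList := S.map (Prod.map φ φ)

/-- Split off the first arc that has `x` as an end point, together with its other end point. -/
def pull (x : ℕ) : ArcList → Option (ℕ × ArcList)
  | [] => none
  | (u, v) :: S => if u = x then some (v, S) else if v = x then some (u, S) else
      (pull x S).map fun q => (q.1, (u, v) :: q.2)

/-- Erase a point at which two arcs meet, and count the closed curve that is lost if the two arcs
are the same. -/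
def contract (x : ℕ) (S : ArcList) : ArcList × ℕ :=
  match pull x S with
  | none => (S, 0)
  | some (y, Q) => if y = x then (Q, 1) else
      match pull x Q with
      | none => (S, 0)
      | some (z, R) => ((y, z) :: R, 0)

/-- List the end points of the arcs in increasing order. -/
def normalize (S : ArcList) : ArcList :=
  (S.map fun p => if p.1 ≤ p.2 then p else (p.2, p.1)).insertionSort fun p q => p.1 ≤ q.1

/-- Erase several points and normalize the result. -/
def reduce : List ℕ → ArcList → ArcList × ℕ
  | [], S => (normalize S, 0)
  | x :: xs, S => ((reduce xs (contract x S).1).1, (contract x S).2 + (reduce xs (contract x S).1).2)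

/-- The points to be erased disappear. -/
def reducible : List ℕ → ArcList → Bool
  | [], S => decide (normalize S ≠ [])
  | x :: xs, S => decide (x ∉ ends (contract x S).1) && reducible xs (contract x S).1

theorem comps_pull {x y : ℕ} {S Q : ArcList} (h : pull x S = some (y, Q)) (φ : ℕ → ℕ) :
    ∀ L, comps (rename φ S ++ L) = comps ((φ x, φ y) :: (rename φ Q ++ L)) := by
  induction S generalizing y Q with
  | nil => simp [pull] at h
  | cons p S ih =>
    obtain ⟨u, v⟩ := p
    intro L
    rw [pull] at h
    split_ifs at h with h1 h2
    · simp only [Option.some.injEq, Prod.mk.injEq] at h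
      obtain ⟨rfl, rfl⟩ := h
      subst h1
      rfl
    · simp only [Option.some.injEq, Prod.mk.injEq] at h
      obtain ⟨rfl, rfl⟩ := h
      subst h2
      rw [comps_flip]
      rfl
    · simp only [Option.map_eq_some_iff, Prod.mk.injEq] at h
      obtain ⟨⟨y', Q'⟩, h3, rfl, rfl⟩ := h
      have := ih h3 ((φ u, φ v) :: L)
      rw [comps_perm List.perm_middle] at this
      refine this.trans (comps_perm ?_)
      exact (List.perm_middle.cons _).trans (.refl _)

/-- The absence of `x` after the erasure excludes a third arc at `x`. The renaming has to separate
only `x` from the other symbols: different symbols for outer ends may stand for the same edge. -/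
theorem comps_contract_rename {x : ℕ} {S : ArcList} (hx : x ∉ ends (contract x S).1) {φ : ℕ → ℕ}
    (hφ : ∀ y, y ≠ x → φ y ≠ φ x) {L : ArcList} (hL : φ x ∉ ends L) :
    comps (rename φ S ++ L) = comps (rename φ (contract x S).1 ++ L) + (contract x S).2 := by
  have notMem : ∀ Q : ArcList, x ∉ ends Q → φ x ∉ ends (rename φ Q ++ L) := by
    intro Q hQ h
    rw [ends_append, List.mem_append] at h
    rcases h with h | h
    · induction Q with
      | nil => simp [rename] at h
      | cons q Q ih =>
        simp only [ends_cons, List.mem_cons, not_or] at hQ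
        simp only [rename, List.map_cons, ends_cons, List.mem_cons, Prod.map] at h
        rcases h with h | h | h
        · exact hφ _ (Ne.symm hQ.1) h.symm
        · exact hφ _ (Ne.symm hQ.2.1) h.symm
        · exact ih hQ.2.2 h
    · exact hL h
  rw [contract] at hx ⊢
  split at hx
  · rfl
  · next y Q h =>
    split_ifs at hx with hy
    · subst hy
      rw [comps_pull h, if_pos rfl]
      exact comps_loop (notMem _ hx)
    · rw [if_neg hy]
      split at hx
      · rfl
      · next z R h' =>
        simp only [ends_cons, List.mem_cons, not_or] at hx
        have := comps_pull h' φ ((φ y, φ x) :: L)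
        rw [comps_pull h, comps_flip, ← comps_perm List.perm_middle, this]
        dsimp only
        rw [Nat.add_zero]
        refine comps_contract_of_perm (x := φ x) ?_ (hφ _ hy).symm (hφ _ (Ne.symm hx.2.1)).symm (notMem _ hx.2.2)
        exact (List.perm_middle.cons _).trans (.swap _ _ _)

theorem comps_normalize (φ : ℕ → ℕ) (S L : ArcList) :
    comps (rename φ (normalize S) ++ L) = comps (rename φ S ++ L) := by
  have h1 : (rename φ (normalize S) ++ L).Perm
      (rename φ (S.map fun p => if p.1 ≤ p.2 then p else (p.2, p.1)) ++ L) :=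
    ((List.perm_insertionSort _ _).map _).append_right _
  rw [comps_perm h1]
  clear h1
  induction S generalizing L with
  | nil => rfl
  | cons p S ih =>
    have h2 := ih (Prod.map φ φ p :: L)
    rw [comps_perm List.perm_middle, comps_perm (List.perm_middle (l₁ := rename φ S))] at h2
    rw [rename, rename, List.map_cons, List.map_cons, List.map_cons]
    split_ifs
    · exact h2
    · exact (comps_flip _ _ _).trans h2

theorem comps_reduce (xs : List ℕ) : ∀ (S : ArcList), reducible xs S = true → ∀ {φ : ℕ → ℕ} {L : ArcList},
    (∀ x ∈ xs, (∀ y, y ≠ x → φ y ≠ φ x) ∧ φ x ∉ ends L) →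
    comps (rename φ S ++ L) = comps (rename φ (reduce xs S).1 ++ L) + (reduce xs S).2 ∧ (reduce xs S).1 ≠ [] := by
  induction xs with
  | nil =>
    intro S hS φ L _
    exact ⟨(comps_normalize φ S L).symm, by simpa [reducible, reduce] using hS⟩
  | cons x xs ih =>
    intro S hS φ L h
    simp only [reducible, Bool.and_eq_true, decide_eq_true_eq] at hS
    obtain ⟨h1, h2⟩ := ih _ hS.2 (φ := φ) (L := L) fun x hx => h x (by simp [hx])
    refine ⟨?_, h2⟩
    rw [comps_contract_rename hS.1 (h x (by simp)).1 (h x (by simp)).2, h1, reduce]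
    ring

end ArcList

/-- Rename the edges. -/
def DiagramNode.rename (φ : ℕ → ℕ) : DiagramNode → DiagramNode
  | crossing k a b c d => crossing k (φ a) (φ b) (φ c) (φ d)
  | join a b => join (φ a) (φ b)

namespace PDCode

open DiagramNode LaurentPolynomial ArcList

/-- A symbolic term: a coefficient, an exponent, and arcs. -/
abbrev SkeinTerm := ℤ × ℤ × ArcList

namespace SkeinTerm

/-- The value of a symbolic term when the arcs `L` are added. -/
noncomputable def value (φ : ℕ → ℕ) (L : ArcList) (t : SkeinTerm) : LaurentPolynomial ℤ :=
  t.1 • (T t.2.1 * (-T 2 - T (-2)) ^ (comps (ArcList.rename φ t.2.2 ++ L) - 1))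

/-- The value of a sum of symbolic terms. -/
noncomputable def valueSum (φ : ℕ → ℕ) (L : ArcList) (ts : List SkeinTerm) : LaurentPolynomial ℤ :=
  (ts.map (value φ L)).sum

/-- The state sum of a code whose crossings are all spliced. -/
def expand (e : ℤ) (S : ArcList) : PDCode → List SkeinTerm
  | [] => [(1, e, S)]
  | n :: C => if n.IsReal then
      expand (e + 1) (arcs (n.spliceBy .A) ++ S) C ++ expand (e - 1) (arcs (n.spliceBy .B) ++ S) C
    else expand e (n.strands ++ S) C

/-- Multiplication by `-T 2 - T (-2)`. -/
def mulLoop (ts : List SkeinTerm) : List SkeinTerm :=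
  ts.flatMap fun t => [(-t.1, t.2.1 + 2, t.2.2), (-t.1, t.2.1 - 2, t.2.2)]

/-- Erase points in the arcs of a term. -/
def reduceTerm (xs : List ℕ) (t : SkeinTerm) : List SkeinTerm :=
  mulLoop^[(reduce xs t.2.2).2] [(t.1, t.2.1, (reduce xs t.2.2).1)]

/-- Multiplication by `c * T k`. -/
def scale (c k : ℤ) (ts : List SkeinTerm) : List SkeinTerm := ts.map fun t => (c * t.1, t.2.1 + k, t.2.2)

/-- Add a term to a sum, collecting like terms. -/
def insert (t : SkeinTerm) : List SkeinTerm → List SkeinTerm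
  | [] => [t]
  | u :: us => if t.2 = u.2 then (t.1 + u.1, u.2) :: us else u :: insert t us

/-- Collect like terms and compare with zero. -/
def isZero (ts : List SkeinTerm) : Bool := (ts.foldr insert []).all fun t => decide (t.1 = 0)

/-- The end points of the arcs are among the first `m` symbols. -/
def bounded (m : ℕ) (ts : List SkeinTerm) : Bool := ts.all fun t => (ArcList.ends t.2.2).all fun x => decide (x < m)

/-- The two codes, in which the symbols `xs` and `ys` may be erased, have the same state sums up to
the factor `c * T k`. -/
def check (m : ℕ) (c k : ℤ) (l : PDCode) (xs : List ℕ) (r : PDCode) (ys : List ℕ) : Bool :=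
  (expand 0 [] l).all (fun t => reducible xs t.2.2) &&
  (expand 0 [] r).all (fun t => reducible ys t.2.2) &&
  bounded m ((expand 0 [] l).flatMap (reduceTerm xs)) &&
  bounded m ((expand 0 [] r).flatMap (reduceTerm ys)) &&
  isZero ((expand 0 [] l).flatMap (reduceTerm xs) ++ scale (-c) k ((expand 0 [] r).flatMap (reduceTerm ys)))

variable {φ ψ : ℕ → ℕ} {L : ArcList}

@[simp] theorem valueSum_nil : valueSum φ L [] = 0 := rfl

@[simp] theorem valueSum_cons (t : SkeinTerm) (ts : List SkeinTerm) :
    valueSum φ L (t :: ts) = value φ L t + valueSum φ L ts := by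
  simp [valueSum]

@[simp] theorem valueSum_append (ts us : List SkeinTerm) :
    valueSum φ L (ts ++ us) = valueSum φ L ts + valueSum φ L us := by
  simp [valueSum]

theorem arcs_spliceBy_rename (X : Splice) (n : DiagramNode) :
    arcs ((n.rename φ).spliceBy X) = ArcList.rename φ (arcs (n.spliceBy X)) := by
  rcases n with ⟨_ | _ | _, a, b, c, d⟩ | ⟨a, b⟩ <;> cases X <;> rfl

theorem strands_rename (n : DiagramNode) : (n.rename φ).strands = ArcList.rename φ n.strands := by
  rcases n with ⟨k, a, b, c, d⟩ | ⟨a, b⟩ <;> rfl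

theorem isReal_rename (n : DiagramNode) : (n.rename φ).IsReal ↔ n.IsReal := by
  rcases n with ⟨k, a, b, c, d⟩ | ⟨a, b⟩ <;> rfl

theorem valueSum_expand (l : PDCode) : ∀ (e : ℤ) (S : ArcList) (E : PDCode), arcs E = ArcList.rename φ S ++ L →
    valueSum φ L (expand e S l) = T e * skein .A (l.map (DiagramNode.rename φ)) E := by
  induction l with
  | nil =>
    intro e S E h
    simp [expand, skein_nil, numComponents_eq_comps, h, value]
  | cons n l ih =>
    intro e S E h
    rw [expand, List.map_cons]
    split_ifs with hn
    · rw [skein_cons_real _ ((isReal_rename n).2 hn), valueSum_append, ih _ _ ((n.rename φ).spliceBy .A ++ E),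
        ih _ _ ((n.rename φ).spliceBy .B ++ E), T_add, T_sub, Splice.other]
      · ring
      · rw [arcs_append, arcs_spliceBy_rename, h]
        simp [ArcList.rename]
      · rw [arcs_append, arcs_spliceBy_rename, h]
        simp [ArcList.rename]
    · rw [skein_cons_not_real _ (mt (isReal_rename n).1 hn), ih _ _ (n.rename φ :: E)]
      rw [arcs_cons, strands_rename, h]
      simp [ArcList.rename]

theorem valueSum_mulLoop (ts : List SkeinTerm) :
    valueSum φ L (mulLoop ts) = (-T 2 - T (-2)) * valueSum φ L ts := by
  induction ts with
  | nil => simp [mulLoop]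
  | cons t ts ih =>
    rw [mulLoop, List.flatMap_cons, valueSum_append, ← mulLoop, ih, valueSum_cons, valueSum_cons, valueSum_cons,
      valueSum_nil, mul_add]
    simp only [value, T_add, T_sub, neg_smul, zsmul_eq_mul]
    ring

theorem valueSum_reduceTerm {xs : List ℕ} (t : SkeinTerm) (ht : reducible xs t.2.2 = true)
    (h : ∀ x ∈ xs, (∀ y, y ≠ x → φ y ≠ φ x) ∧ φ x ∉ ArcList.ends L) :
    valueSum φ L (reduceTerm xs t) = value φ L t := by
  obtain ⟨h1, h2⟩ := comps_reduce xs t.2.2 ht h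
  have iter : ∀ (k : ℕ) (ts : List SkeinTerm),
      valueSum φ L (mulLoop^[k] ts) = (-T 2 - T (-2)) ^ k * valueSum φ L ts := by
    intro k
    induction k with
    | zero => simp
    | succ k ih =>
      intro ts
      rw [Function.iterate_succ_apply', valueSum_mulLoop, ih]
      ring
  rw [reduceTerm, iter, valueSum_cons, valueSum_nil, add_zero, value, value, h1]
  -- Some arc is left, so the number of components is positive and the truncated subtraction in the
  -- exponent commutes with adding the erased loops.
  obtain ⟨p, P, hp⟩ := List.exists_cons_of_ne_nil h2
  have hpos : 0 < comps (ArcList.rename φ (reduce xs t.2.2).1 ++ L) := by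
    rw [hp]
    exact comps_pos
  rw [Nat.sub_add_comm hpos, pow_add]
  simp only [zsmul_eq_mul]
  ring

theorem valueSum_flatMap_reduceTerm {xs : List ℕ} (ts : List SkeinTerm)
    (ht : ts.all (fun t => reducible xs t.2.2) = true)
    (h : ∀ x ∈ xs, (∀ y, y ≠ x → φ y ≠ φ x) ∧ φ x ∉ ArcList.ends L) :
    valueSum φ L (ts.flatMap (reduceTerm xs)) = valueSum φ L ts := by
  induction ts with
  | nil => rfl
  | cons t ts ih =>
    simp only [List.all_cons, Bool.and_eq_true] at ht
    rw [List.flatMap_cons, valueSum_append, valueSum_cons, ih ht.2, valueSum_reduceTerm t ht.1 h]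

theorem valueSum_scale (c k : ℤ) (ts : List SkeinTerm) :
    valueSum φ L (scale c k ts) = c • (T k * valueSum φ L ts) := by
  induction ts with
  | nil => simp [scale]
  | cons t ts ih =>
    rw [scale, List.map_cons, valueSum_cons, ← scale, ih, valueSum_cons]
    simp only [value, T_add, zsmul_eq_mul]
    push_cast
    ring

theorem valueSum_insert (t : SkeinTerm) (us : List SkeinTerm) :
    valueSum φ L (insert t us) = value φ L t + valueSum φ L us := by
  induction us with
  | nil => rfl
  | cons u us ih =>
    rw [insert]
    split_ifs with h
    · rw [valueSum_cons, valueSum_cons, value, value, value, h, add_smul]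
      ring
    · rw [valueSum_cons, valueSum_cons, ih]
      ring

theorem valueSum_eq_zero {ts : List SkeinTerm} (h : isZero ts = true) : valueSum φ L ts = 0 := by
  have h1 : valueSum φ L (ts.foldr insert []) = valueSum φ L ts := by
    clear h
    induction ts with
    | nil => rfl
    | cons t ts ih => rw [List.foldr_cons, valueSum_insert, ih, valueSum_cons]
  rw [← h1]
  rw [isZero] at h
  generalize ts.foldr insert [] = us at h
  induction us with
  | nil => rfl
  | cons u us ih =>
    simp only [List.all_cons, Bool.and_eq_true, decide_eq_true_eq] at h
    rw [valueSum_cons, ih h.2, value, h.1, zero_smul, add_zero]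

theorem valueSum_congr {m : ℕ} {ts : List SkeinTerm} (h : bounded m ts = true) (hm : ∀ x < m, φ x = ψ x) :
    valueSum φ L ts = valueSum ψ L ts := by
  refine congrArg List.sum (List.map_congr_left fun t ht => ?_)
  have h1 : ArcList.rename φ t.2.2 = ArcList.rename ψ t.2.2 := by
    refine List.map_congr_left fun p hp => ?_
    have h2 := List.all_eq_true.1 (List.all_eq_true.1 h t ht)
    have h3 := of_decide_eq_true (h2 p.1 (mem_ends_left (y := p.2) hp))
    have h4 := of_decide_eq_true (h2 p.2 (mem_ends_right (x := p.1) hp))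
    simp only [Prod.map, hm _ h3, hm _ h4]
  rw [value, value, h1]

/-- Soundness of the symbolic computation. Symbols below `m` stand for the outer edges shared by
both sides, where `φ` and `ψ` agree; the inner edges of the two sides are named independently and
have been erased. -/
theorem skein_eq_of_check {m : ℕ} {c k : ℤ} {l r : PDCode} {xs ys : List ℕ} (h : check m c k l xs r ys = true)
    (hm : ∀ x < m, φ x = ψ x) {E : PDCode}
    (hφ : ∀ x ∈ xs, (∀ y, y ≠ x → φ y ≠ φ x) ∧ φ x ∉ allEnds E)
    (hψ : ∀ x ∈ ys, (∀ y, y ≠ x → ψ y ≠ ψ x) ∧ ψ x ∉ allEnds E) :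
    skein .A (l.map (DiagramNode.rename φ)) E = c • T k * skein .A (r.map (DiagramNode.rename ψ)) E := by
  simp only [check, Bool.and_eq_true] at h
  obtain ⟨⟨⟨⟨h1, h2⟩, h3⟩, h4⟩, h5⟩ := h
  simp only [← mem_ends_arcs] at hφ hψ
  have e1 := valueSum_expand (φ := φ) (L := arcs E) l 0 [] E rfl
  have e2 := valueSum_expand (φ := ψ) (L := arcs E) r 0 [] E rfl
  rw [T_zero, one_mul] at e1 e2
  rw [← e1, ← e2, ← valueSum_flatMap_reduceTerm _ h1 hφ, ← valueSum_flatMap_reduceTerm _ h2 hψ,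
    ← valueSum_congr h4 hm]
  have e3 := valueSum_eq_zero (φ := φ) (L := arcs E) h5
  rw [valueSum_append, valueSum_scale, neg_smul, ← sub_eq_add_neg, sub_eq_zero] at e3
  rw [e3, smul_mul_assoc]

end SkeinTerm

end PDCode

/-! ### The effect of the local moves on the bracket. -/

namespace PDCode

open DiagramNode LaurentPolynomial CrossingKind

/-- An inner edge of a move has both its ends there, hence differs from all outer edges and from the
rest of the diagram. -/
theorem TwoEnds.notMem {C : PDCode} (h : TwoEnds C) {x : ℕ} {S : List ℕ} (hp : (allEnds C).Perm (x :: x :: S)) :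
    x ∉ S := by
  have h1 := h x (hp.mem_iff.2 (by simp))
  rw [hp.count_eq, List.count_cons_self, List.count_cons_self] at h1
  exact List.count_eq_zero.1 (by omega)

/-- Provides the separation condition for renamings given by a list of edges; symbols beyond the
list take the default value `d`, whence the condition `x ≠ d`. -/
theorem getD_ne {V : List ℕ} {d i x : ℕ} (h : x ∉ V.eraseIdx i) (hd : x ≠ d) (j : ℕ) (hj : j ≠ i) :
    V.getD j d ≠ x := by
  by_cases hl : j < V.length
  · rw [List.getD_eq_getElem _ _ hl]
    exact fun e => h (List.mem_eraseIdx_iff_getElem.2 ⟨j, hl, hj, e⟩)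
  · rw [List.getD_eq_default _ _ (not_lt.1 hl)]
    exact hd.symm

/-- Kauffman's computation, carried out on symbols: only the real curl contributes a factor other
than 1. -/
theorem _root_.LocalMove.skein_eq {l r : PDCode} (h : LocalMove l r) : ∃ c k : ℤ, (c = 1 ∨ c = -1) ∧
    ∀ L, TwoEnds (l ++ L) → TwoEnds (r ++ L) → skein .A l L = c • T k * skein .A r L := by
  cases h with
  | rotate k a b c d =>
    refine ⟨1, 0, .inl rfl, fun L _ _ => ?_⟩
    have hc : SkeinTerm.check 4 1 0 [crossing k 0 1 2 3] [] [crossing k.rotate 1 2 3 0] [] = true := by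
      cases k <;> decide
    exact SkeinTerm.skein_eq_of_check (φ := fun n => [a, b, c, d].getD n a) hc (fun _ _ => rfl) (by simp) (by simp)
  | flip a b =>
    refine ⟨1, 0, .inl rfl, fun L _ _ => ?_⟩
    have hc : SkeinTerm.check 2 1 0 [join 0 1] [] [join 1 0] [] = true := by decide
    exact SkeinTerm.skein_eq_of_check (φ := fun n => [a, b].getD n a) hc (fun _ _ => rfl) (by simp) (by simp)
  | markCrossing k a b c d x =>
    refine ⟨1, 0, .inl rfl, fun L _ hr => ?_⟩
    have hc : SkeinTerm.check 4 1 0 [crossing k 0 1 2 3] [] [crossing k 4 1 2 3, join 4 0] [4] = true := by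
      cases k <;> decide
    have hx : x ∉ b :: c :: d :: a :: allEnds L := hr.notMem (by
      rw [List.perm_iff_count]; intro e; simp [DiagramNode.ends, List.count_cons]; ring)
    simp only [List.mem_cons, not_or] at hx
    refine SkeinTerm.skein_eq_of_check (φ := fun n => [a, b, c, d, x].getD n a) hc (fun _ _ => rfl) (by simp) ?_
    intro y hy
    obtain rfl : y = 4 := by simpa using hy
    exact ⟨getD_ne (by simp [hx]) (by simp [hx]), by simp [hx]⟩
  | markJoin a b x =>
    refine ⟨1, 0, .inl rfl, fun L _ hr => ?_⟩
    have hc : SkeinTerm.check 2 1 0 [join 0 1] [] [join 0 2, join 2 1] [2] = true := by decide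
    have hx : x ∉ b :: a :: allEnds L := hr.notMem (by
      rw [List.perm_iff_count]; intro e; simp [DiagramNode.ends, List.count_cons]; ring)
    simp only [List.mem_cons, not_or] at hx
    refine SkeinTerm.skein_eq_of_check (φ := fun n => [a, b, x].getD n a) hc (fun _ _ => rfl) (by simp) ?_
    intro y hy
    obtain rfl : y = 2 := by simpa using hy
    exact ⟨getD_ne (by simp [hx]) (by simp [hx]), by simp [hx]⟩
  | move₁ k a b x =>
    have hc : ∃ c e : ℤ, (c = 1 ∨ c = -1) ∧
        SkeinTerm.check 2 c e [crossing k 2 2 0 1] [2] [join 0 1] [] = true := by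
      -- One splice of a real curl cuts off a loop, giving `A + A⁻¹(-A² - A⁻²) = -A⁻³` or the mirror
      -- image `-A³`. A virtual curl is not spliced.
      cases k
      · exact ⟨-1, -3, .inr rfl, by decide⟩
      · exact ⟨-1, 3, .inr rfl, by decide⟩
      · exact ⟨1, 0, .inl rfl, by decide⟩
    obtain ⟨c, e, hce, hc⟩ := hc
    refine ⟨c, e, hce, fun L hl _ => ?_⟩
    have hx : x ∉ a :: b :: allEnds L := hl.notMem (by
      rw [List.perm_iff_count]; intro e; simp [DiagramNode.ends, List.count_cons])
    simp only [List.mem_cons, not_or] at hx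
    refine SkeinTerm.skein_eq_of_check (φ := fun n => [a, b, x].getD n a) hc (fun _ _ => rfl) ?_ (by simp)
    intro y hy
    obtain rfl : y = 2 := by simpa using hy
    exact ⟨getD_ne (by simp [hx]) (by simp [hx]), by simp [hx]⟩
  | move₂ k a b c d x y =>
    refine ⟨1, 0, .inl rfl, fun L hl _ => ?_⟩
    have hc : SkeinTerm.check 4 1 0 [crossing k 0 2 4 5, crossing k 1 5 4 3] [4, 5] [join 0 1, join 2 3] [] = true := by
      cases k <;> decide
    have hx : x ∉ a :: c :: y :: b :: y :: d :: allEnds L := hl.notMem (by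
      rw [List.perm_iff_count]; intro e; simp [DiagramNode.ends, List.count_cons]; ring)
    have hy : y ∉ a :: c :: x :: b :: x :: d :: allEnds L := hl.notMem (by
      rw [List.perm_iff_count]; intro e; simp [DiagramNode.ends, List.count_cons]; ring)
    simp only [List.mem_cons, not_or] at hx hy
    refine SkeinTerm.skein_eq_of_check (φ := fun n => [a, b, c, d, x, y].getD n a) hc (fun _ _ => rfl) ?_ (by simp)
    intro t ht
    have ht : t = 4 ∨ t = 5 := by simpa using ht
    rcases ht with rfl | rfl <;>
    · exact ⟨getD_ne (by simp [hx, hy]) (by simp [hx, hy]), by simp [hx, hy]⟩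
  | move₃ k₁₂ k₁₃ k₂₃ h a b c p q r x y z u v w =>
    refine ⟨1, 0, .inl rfl, fun L hl hr => ?_⟩
    have hc : SkeinTerm.check 6 1 0
        [crossing k₁₂ 0 1 6 7, crossing k₁₃ 6 2 3 8, crossing k₂₃ 7 8 4 5] [6, 7, 8]
        [crossing k₁₂ 6 7 3 4, crossing k₁₃ 0 8 6 5, crossing k₂₃ 1 2 7 8] [6, 7, 8] = true := by
      revert h
      cases k₁₂ <;> cases k₁₃ <;> cases k₂₃ <;> first
        | exact fun _ => by decide
        | exact fun h => absurd h (by simp [TriangleAllowed])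
    have hx : x ∉ a :: b :: y :: c :: p :: z :: y :: z :: q :: r :: allEnds L := hl.notMem (by
      rw [List.perm_iff_count]; intro e; simp [DiagramNode.ends, List.count_cons]; ring)
    have hy : y ∉ a :: b :: x :: x :: c :: p :: z :: z :: q :: r :: allEnds L := hl.notMem (by
      rw [List.perm_iff_count]; intro e; simp [DiagramNode.ends, List.count_cons]; ring)
    have hz : z ∉ a :: b :: x :: y :: x :: c :: p :: y :: q :: r :: allEnds L := hl.notMem (by
      rw [List.perm_iff_count]; intro e; simp [DiagramNode.ends, List.count_cons]; ring)
    have hu : u ∉ v :: p :: q :: a :: w :: r :: b :: c :: v :: w :: allEnds L := hr.notMem (by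
      rw [List.perm_iff_count]; intro e; simp [DiagramNode.ends, List.count_cons]; ring)
    have hv : v ∉ u :: p :: q :: a :: w :: u :: r :: b :: c :: w :: allEnds L := hr.notMem (by
      rw [List.perm_iff_count]; intro e; simp [DiagramNode.ends, List.count_cons]; ring)
    have hw : w ∉ u :: v :: p :: q :: a :: u :: r :: b :: c :: v :: allEnds L := hr.notMem (by
      rw [List.perm_iff_count]; intro e; simp [DiagramNode.ends, List.count_cons]; ring)
    simp only [List.mem_cons, not_or] at hx hy hz hu hv hw
    refine SkeinTerm.skein_eq_of_check (φ := fun n => [a, b, c, p, q, r, x, y, z].getD n a)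
      (ψ := fun n => [a, b, c, p, q, r, u, v, w].getD n a) hc ?_ ?_ ?_
    · intro j hj
      interval_cases j <;> rfl
    all_goals
      intro t ht
      have ht : t = 6 ∨ t = 7 ∨ t = 8 := by simpa using ht
      rcases ht with rfl | rfl | rfl <;>
      · exact ⟨getD_ne (by simp [hx, hy, hz, hu, hv, hw]) (by simp [hx, hy, hz, hu, hv, hw]), by simp [hx, hy, hz, hu, hv, hw]⟩

end PDCode

/-! ### The span of a Laurent polynomial. -/

section LaurentSpan

open LaurentPolynomial

theorem coeff_T_mul (k : ℤ) (f : LaurentPolynomial ℤ) (e : ℤ) : (T k * f).coeff e = f.coeff (e - k) := by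
  rw [T, AddMonoidAlgebra.coeff_single_mul_apply]
  simp [add_comm, sub_eq_add_neg]

theorem laurentSpan_eq {f : LaurentPolynomial ℤ} {m M : ℤ} (hM : f.coeff M ≠ 0) (hm : f.coeff m ≠ 0)
    (h : ∀ e, f.coeff e ≠ 0 → m ≤ e ∧ e ≤ M) : laurentSpan f = M - m := by
  have hne : f.coeff.support.Nonempty := ⟨M, Finsupp.mem_support_iff.2 hM⟩
  rw [laurentSpan, dif_pos hne]
  congr 1
  · refine le_antisymm (Finset.max'_le _ _ _ fun e he => (h e (Finsupp.mem_support_iff.1 he)).2) ?_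
    exact Finset.le_max' _ _ (Finsupp.mem_support_iff.2 hM)
  · refine le_antisymm ?_ (Finset.le_min' _ _ _ fun e he => (h e (Finsupp.mem_support_iff.1 he)).1)
    exact Finset.min'_le _ _ (Finsupp.mem_support_iff.2 hm)

theorem laurentSpan_zero : laurentSpan 0 = 0 := by
  simp [laurentSpan]

theorem exists_laurentSpan_eq {f : LaurentPolynomial ℤ} (hf : f ≠ 0) : ∃ m M, f.coeff M ≠ 0 ∧ f.coeff m ≠ 0 ∧
    (∀ e, f.coeff e ≠ 0 → m ≤ e ∧ e ≤ M) ∧ laurentSpan f = M - m := by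
  have hne : f.coeff.support.Nonempty := by
    rw [Finsupp.support_nonempty_iff]
    simpa using hf
  refine ⟨f.coeff.support.min' hne, f.coeff.support.max' hne, ?_, ?_, ?_, dif_pos hne⟩
  · exact Finsupp.mem_support_iff.1 (Finset.max'_mem _ hne)
  · exact Finsupp.mem_support_iff.1 (Finset.min'_mem _ hne)
  · exact fun e he => ⟨Finset.min'_le _ _ (Finsupp.mem_support_iff.2 he),
      Finset.le_max' _ _ (Finsupp.mem_support_iff.2 he)⟩

theorem laurentSpan_smul_T_mul {c : ℤ} (hc : c ≠ 0) (k : ℤ) (f : LaurentPolynomial ℤ) :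
    laurentSpan (c • T k * f) = laurentSpan f := by
  by_cases hf : f = 0
  · simp [hf]
  obtain ⟨m, M, hM, hm, h, hs⟩ := exists_laurentSpan_eq hf
  have hco : ∀ e, (c • T k * f).coeff e = c * f.coeff (e - k) := by
    intro e
    rw [smul_mul_assoc, AddMonoidAlgebra.coeff_smul_apply, coeff_T_mul, smul_eq_mul]
  rw [hs, laurentSpan_eq (m := m + k) (M := M + k)]
  · ring
  · rw [hco, add_sub_cancel_right]
    exact mul_ne_zero hc hM
  · rw [hco, add_sub_cancel_right]
    exact mul_ne_zero hc hm
  · intro e he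
    rw [hco] at he
    have := h _ (right_ne_zero_of_mul he)
    constructor <;> linarith [this.1, this.2]

theorem four_dvd_laurentSpan {f : LaurentPolynomial ℤ} (r : ℤ) (h : ∀ e, f.coeff e ≠ 0 → (4 : ℤ) ∣ e - r) :
    (4 : ℤ) ∣ laurentSpan f := by
  by_cases hf : f = 0
  · simp [hf, laurentSpan_zero]
  obtain ⟨m, M, hM, hm, -, hs⟩ := exists_laurentSpan_eq hf
  rw [hs]
  have := dvd_sub (h M hM) (h m hm)
  simpa using this

end LaurentSpan

/-! ### Invariance of the span. -/

namespace VirtualLinkDiagram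

open PDCode

theorem Step.bracketSpan_eq {D E : VirtualLinkDiagram} (h : Step D E) : D.bracketSpan = E.bracketSpan := by
  obtain ⟨l, r, C, hlr, hD, hE⟩ := h
  obtain ⟨c, k, hc, hs⟩ := hlr.skein_eq
  have hD2 : TwoEnds (l ++ (C ++ [])) := by
    rw [List.append_nil]
    exact TwoEnds.of_perm D.two_ends (hD.flatMap_right _)
  have hE2 : TwoEnds (r ++ (C ++ [])) := by
    rw [List.append_nil]
    exact TwoEnds.of_perm E.two_ends (hE.flatMap_right _)
  have := skein_congr .A _ hs C [] hD2 hE2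
  rw [bracketSpan, bracketSpan, bracket_eq_skein, bracket_eq_skein,
    skein_perm_left _ (hD.trans List.perm_append_comm), skein_perm_left _ (hE.trans List.perm_append_comm), this]
  exact laurentSpan_smul_T_mul (by rcases hc with rfl | rfl <;> decide) _ _

theorem Equivalent.bracketSpan_eq {D E : VirtualLinkDiagram} (h : Equivalent D E) :
    D.bracketSpan = E.bracketSpan := by
  induction h with
  | rel _ _ h => exact h.bracketSpan_eq
  | refl _ => rfl
  | symm _ _ _ ih => exact ih.symm
  | trans _ _ _ _ _ ih ih' => exact ih.trans ih'

end VirtualLinkDiagram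

/-! ### Checkerboard colourings by linear algebra modulo 2. -/

section Labelling

open Classical in
/-- The incidence matrix of two maps, modulo 2. -/
noncomputable def incidence {X Y Z : Type*} [Fintype X] (p : X → Y) (q : X → Z) : Matrix Y Z (ZMod 2) :=
  Matrix.of fun y z => ∑ x, if p x = y ∧ q x = z then 1 else 0

open Classical in
theorem incidence_mulVecLin {X Y Z : Type*} [Fintype X] [Fintype Z] (p : X → Y) (q : X → Z) (g : Z → ZMod 2)
    (y : Y) : (incidence p q).mulVecLin g y = ∑ x, if p x = y then g (q x) else 0 := by
  simp only [Matrix.mulVecLin_apply, Matrix.mulVec, dotProduct, incidence, Matrix.of_apply, Finset.sum_mul]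
  rw [Finset.sum_comm]
  refine Finset.sum_congr rfl fun x _ => ?_
  by_cases h : p x = y <;> simp [h]

theorem incidence_transpose {X Y Z : Type*} [Fintype X] (p : X → Y) (q : X → Z) :
    (incidence p q).transpose = incidence q p := by
  ext z y
  classical
  simp only [incidence, Matrix.transpose_apply, Matrix.of_apply]
  exact Finset.sum_congr rfl fun x _ => if_congr and_comm rfl rfl

/-- A space of functions whose pullbacks along `p` are determined by functions on `P` has dimension
at most `|P|`. -/
theorem finrank_le_card_of_factor {X Y P : Type*} [Finite X] [Fintype Y] [Fintype P] {p : X → Y} {piece : X → P}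
    (hp : Function.Surjective p) (W : Submodule (ZMod 2) (Y → ZMod 2))
    (hW : ∀ g ∈ W, ∃ k : P → ZMod 2, g ∘ p = k ∘ piece) : Module.finrank (ZMod 2) W ≤ Fintype.card P := by
  have inj : Function.Injective (LinearMap.funLeft (ZMod 2) (ZMod 2) p) :=
    LinearMap.funLeft_injective_of_surjective _ _ _ hp
  rw [(Submodule.equivMapOfInjective _ inj W).finrank_eq]
  have hle : W.map (LinearMap.funLeft (ZMod 2) (ZMod 2) p) ≤
      LinearMap.range (LinearMap.funLeft (ZMod 2) (ZMod 2) piece) := by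
    rintro _ ⟨g, hg, rfl⟩
    obtain ⟨k, hk⟩ := hW g hg
    exact ⟨k, hk.symm⟩
  refine (Submodule.finrank_mono hle).trans ((LinearMap.finrank_range_le _).trans ?_)
  rw [Module.finrank_fintype_fun_eq_card]

/-- **Checkerboard colouring.** In a combinatorial map of genus zero with vertices of even degree, the
darts can be labelled by `ZMod 2` so that the label changes along the edges and around the vertices. -/
theorem exists_alternating_labelling {X V E F P : Type*} [Fintype X] [Fintype V] [Fintype E] [Fintype F] [Fintype P]
    (vert : X → V) (edge : X → E) (face : X → F) (piece : X → P) (next opp : X → X)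
    (hopp : ∀ x, opp x ≠ x) (hedge : ∀ x y, edge y = edge x ↔ y = x ∨ y = opp x)
    (hnext : Function.Bijective next) (hvn : ∀ x, vert (next x) = vert x)
    (hface : ∀ x, face (next x) = face (opp x))
    (sv : Function.Surjective vert) (sf : Function.Surjective face)
    (hvert : ∀ g : X → ZMod 2, (∀ x, g (next x) = g x) → (∀ x, g (opp x) = g x) → ∃ k : P → ZMod 2, g = k ∘ piece)
    (heven : ∀ v, ∃ m, Nat.card {x // vert x = v} = 2 * m)
    (heuler : Fintype.card V + Fintype.card F = Fintype.card E + 2 * Fintype.card P) :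
    ∃ o : X → ZMod 2, (∀ x, o (opp x) = o x + 1) ∧ ∀ x, o (next x) = o x + 1 := by
  classical
  have two : ∀ a : ZMod 2, a + a = 0 := by decide
  have eq_of_add : ∀ a b : ZMod 2, a + b = 0 → b = a := by decide
  have eq_of_add' : ∀ a b : ZMod 2, a + b = 1 → b = a + 1 := by decide
  -- the sum of a function on darts over the two ends of an edge
  have hsum : ∀ (g : X → ZMod 2) (x : X), (∑ y, if edge y = edge x then g y else 0) = g x + g (opp x) := by
    intro g x
    rw [← Finset.sum_filter]
    have : (Finset.univ.filter fun y => edge y = edge x) = {x, opp x} := by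
      ext y
      simp [hedge]
    rw [this, Finset.sum_pair (hopp x).symm]
  -- `M` and `N` are the boundary maps from edges to vertices and from faces to edges. The Euler
  -- relation will make this complex exact at the edges.
  let M := incidence vert edge
  let N := incidence edge face
  have hM : ∀ g v, M.mulVecLin g v = ∑ x, if vert x = v then g (edge x) else 0 := fun g v => by
    convert incidence_mulVecLin vert edge g v
  have hMT : ∀ h e, M.transpose.mulVecLin h e = ∑ x, if edge x = e then h (vert x) else 0 := fun h e => by
    rw [incidence_transpose]
    convert incidence_mulVecLin edge vert h e
  have hN : ∀ f e, N.mulVecLin f e = ∑ x, if edge x = e then f (face x) else 0 := fun f e => by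
    convert incidence_mulVecLin edge face f e
  -- Elements of the kernels of the transpose of `M` and of `N` are constant on the connected
  -- pieces, so both kernels have dimension at most the number of pieces.
  have k1 : Module.finrank (ZMod 2) (LinearMap.ker M.transpose.mulVecLin) ≤ Fintype.card P := by
    refine finrank_le_card_of_factor sv _ fun h hh =>
      hvert _ (fun x => congrArg h (hvn x)) fun x => eq_of_add _ _ ?_
    have h1 := congrFun (LinearMap.mem_ker.1 hh) (edge x)
    rwa [hMT, hsum fun y => h (vert y)] at h1
  have k2 : Module.finrank (ZMod 2) (LinearMap.ker N.mulVecLin) ≤ Fintype.card P := by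
    have key : ∀ f ∈ LinearMap.ker N.mulVecLin, ∀ x, f (face (opp x)) = f (face x) := by
      intro f hf x
      have h1 := congrFun (LinearMap.mem_ker.1 hf) (edge x)
      rw [hN, hsum fun y => f (face y)] at h1
      exact eq_of_add _ _ h1
    exact finrank_le_card_of_factor sf _ fun f hf =>
      hvert _ (fun x => (congrArg f (hface x)).trans (key f hf x)) (key f hf)
  -- A boundary is a cycle: the face beyond the end `x` is the face of `next x`, so around a vertex
  -- every corner is counted twice.
  have hle : LinearMap.range N.mulVecLin ≤ LinearMap.ker M.mulVecLin := by
    rintro _ ⟨f, rfl⟩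
    rw [LinearMap.mem_ker]
    funext v
    rw [hM]
    have h1 : ∀ x, (if vert x = v then N.mulVecLin f (edge x) else 0) =
        (if vert x = v then f (face x) else 0) + if vert (next x) = v then f (face (next x)) else 0 := by
      intro x
      rw [hN, hsum fun y => f (face y), hvn, hface]
      split_ifs <;> simp
    rw [Finset.sum_congr rfl fun x _ => h1 x, Finset.sum_add_distrib,
      Function.Bijective.sum_comp hnext fun x => if vert x = v then f (face x) else 0]
    exact two _
  have r1 := LinearMap.finrank_range_add_finrank_ker M.mulVecLin
  have r2 := LinearMap.finrank_range_add_finrank_ker M.transpose.mulVecLin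
  have r3 := LinearMap.finrank_range_add_finrank_ker N.mulVecLin
  have r4 : Module.finrank (ZMod 2) (LinearMap.range M.transpose.mulVecLin) =
      Module.finrank (ZMod 2) (LinearMap.range M.mulVecLin) := M.rank_transpose
  rw [Module.finrank_fintype_fun_eq_card] at r1 r2 r3
  -- The rank of `N` is at least `F - P`, and the kernel of `M` has dimension at most `E - V + P`;
  -- these agree by the Euler relation.
  have heq : LinearMap.range N.mulVecLin = LinearMap.ker M.mulVecLin :=
    Submodule.eq_of_le_of_finrank_le hle (by omega)
  -- The sum of all edges is a cycle because the degrees are even, hence the boundary of a set of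
  -- faces. That set is the colouring, and a dart is labelled by the colour of its face.
  have hone : (fun _ => 1 : E → ZMod 2) ∈ LinearMap.ker M.mulVecLin := by
    rw [LinearMap.mem_ker]
    funext v
    obtain ⟨m, hm⟩ := heven v
    rw [Nat.card_eq_fintype_card, Fintype.card_subtype] at hm
    rw [hM, Finset.sum_boole, hm]
    push_cast
    rw [two_mul]
    exact two _
  rw [← heq] at hone
  obtain ⟨f, hf⟩ := hone
  have key : ∀ x, f (face (opp x)) = f (face x) + 1 := by
    intro x
    have h1 := congrFun hf (edge x)
    rw [hN, hsum fun y => f (face y)] at h1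
    exact eq_of_add' _ _ h1
  exact ⟨fun x => f (face x), key, fun x => (congrArg f (hface x)).trans (key x)⟩

end Labelling

/-! ### Planar classical codes have alternating orientations. -/

namespace PDCode

open DiagramNode

theorem count_eq_sum (e : ℕ) (l : List ℕ) : l.count e = ∑ j : Fin l.length, if l.get j = e then 1 else 0 := by
  induction l with
  | nil => rfl
  | cons a l ih =>
    rw [List.count_cons, ih, add_comm]
    refine Eq.trans ?_ (Fin.sum_univ_succ (n := l.length) _).symm
    simp only [beq_iff_eq]
    rfl

theorem sum_dart (C : PDCode) (f : Dart C → ℕ) :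
    ∑ x, f x = ∑ i : Fin C.length, ∑ j : Fin (C.get i).ends.length, f ⟨i, j⟩ :=
  Fintype.sum_sigma f

theorem sum_dart_cons (n : DiagramNode) (C : PDCode) (f : Dart (n :: C) → ℕ) :
    ∑ x, f x = ∑ j : Fin n.ends.length, f ⟨(0 : Fin (C.length + 1)), j⟩ +
      ∑ x : Dart C, f ⟨x.1.succ, x.2⟩ := by
  rw [sum_dart, sum_dart]
  exact Fin.sum_univ_succ _

theorem count_allEnds (e : ℕ) (C : PDCode) :
    (allEnds C).count e = ∑ x : Dart C, if x.edge = e then 1 else 0 := by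
  induction C with
  | nil => rfl
  | cons n C ih =>
    rw [allEnds_cons, List.count_append, ih, sum_dart_cons, count_eq_sum]
    rfl

theorem Dart.edge_mem {C : PDCode} (x : Dart C) : x.edge ∈ allEnds C :=
  List.mem_flatMap.2 ⟨_, List.get_mem C x.1, List.get_mem _ x.2⟩

theorem Dart.exists_of_mem {C : PDCode} {i : Fin C.length} {e : ℕ} (h : e ∈ (C.get i).ends) :
    ∃ x : Dart C, x.1 = i ∧ x.edge = e := by
  obtain ⟨j, hj⟩ := List.get_of_mem h
  exact ⟨⟨i, j⟩, rfl, hj⟩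

theorem Dart.next_injective {C : PDCode} : Function.Injective (Dart.next (C := C)) := by
  rintro ⟨i, j⟩ ⟨i', j'⟩ h
  simp only [Dart.next, Sigma.mk.injEq] at h
  obtain ⟨rfl, h⟩ := h
  have h1 := congrArg Fin.val (eq_of_heq h)
  have h2 : j.1 ≡ j'.1 [MOD (C.get i).ends.length] := Nat.ModEq.add_right_cancel' 1 h1
  rw [Nat.ModEq, Nat.mod_eq_of_lt j.2, Nat.mod_eq_of_lt j'.2] at h2
  rw [Fin.ext h2]

theorem TwoEnds.exists_opp {C : PDCode} (h : TwoEnds C) :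
    ∃ opp : Dart C → Dart C, (∀ x, opp x ≠ x) ∧ ∀ x y, y.edge = x.edge ↔ y = x ∨ y = opp x := by
  have : ∀ x : Dart C, ∃ z, z ≠ x ∧ ∀ y : Dart C, y.edge = x.edge ↔ y = x ∨ y = z := by
    intro x
    have h1 := h _ x.edge_mem
    rw [count_allEnds, ← Finset.card_filter, Finset.card_eq_two] at h1
    obtain ⟨u, v, huv, h2⟩ := h1
    have h3 : ∀ y : Dart C, y.edge = x.edge ↔ y = u ∨ y = v := by
      intro y
      simpa using Finset.ext_iff.1 h2 y
    rcases (h3 x).1 rfl with rfl | rfl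
    · exact ⟨v, huv.symm, h3⟩
    · exact ⟨u, huv, fun y => (h3 y).trans or_comm⟩
  choose opp h1 h2 using this
  exact ⟨opp, h1, h2⟩

theorem ends_length (n : DiagramNode) : n.ends.length = 4 ∨ n.ends.length = 2 := by
  cases n <;> simp [DiagramNode.ends]

theorem eq_of_next_invariant {C : PDCode} {α : Type*} (g : Dart C → α) (h : ∀ x : Dart C, g x.next = g x) (i : Fin C.length)
    (j : Fin (C.get i).ends.length) : g ⟨i, j⟩ = g ⟨i, ⟨0, j.pos⟩⟩ := by
  obtain ⟨j, hj⟩ := j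
  induction j with
  | zero => rfl
  | succ j ih =>
    rw [← ih (by omega), ← h ⟨i, ⟨j, by omega⟩⟩]
    congr 1
    simp only [Dart.next, Sigma.mk.injEq, heq_eq_eq, Fin.mk.injEq, true_and]
    exact (Nat.mod_eq_of_lt hj).symm

theorem IsPlanar.exists_alternating {C : PDCode} (hp : IsPlanar C) (h : TwoEnds C) :
    ∃ o : Dart C → ZMod 2, (∀ x y : Dart C, y ≠ x → y.edge = x.edge → o y = o x + 1) ∧
      ∀ x : Dart C, o x.next = o x + 1 := by
  classical
  obtain ⟨opp, h1, h2⟩ := h.exists_opp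
  have oppopp : ∀ x, opp (opp x) = x := by
    intro x
    have h3 : (opp x).edge = x.edge := (h2 x _).2 (.inr rfl)
    rcases (h2 (opp x) x).1 h3.symm with h4 | h4
    · exact absurd h4.symm (h1 x)
    · exact h4.symm
  let F := Quot fun x z : Dart C => ∃ y : Dart C, y ≠ x ∧ y.edge = x.edge ∧ z = y.next
  let P := Quot fun i j : Fin C.length => ∃ e, e ∈ (C.get i).ends ∧ e ∈ (C.get j).ends
  have : Finite (Edge C) := (List.finite_toSet (allEnds C)).to_subtype
  have : Finite F := Quot.finite _
  have : Finite P := Quot.finite _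
  have : Fintype (Edge C) := Fintype.ofFinite _
  have : Fintype F := Fintype.ofFinite _
  have : Fintype P := Fintype.ofFinite _
  have pos : ∀ i : Fin C.length, 0 < (C.get i).ends.length := fun i => by
    rcases ends_length (C.get i) with h | h <;> omega
  obtain ⟨o, ho, ho'⟩ := exists_alternating_labelling (X := Dart C) (fun x => x.1)
    (fun x => (⟨x.edge, x.edge_mem⟩ : Edge C)) (fun x => (Quot.mk _ x : F)) (fun x => (Quot.mk _ x.1 : P))
    Dart.next opp h1 (fun x y => by simpa using h2 x y) (Finite.injective_iff_bijective.1 Dart.next_injective)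
    (fun x => rfl)
    (fun x => (Quot.sound ⟨x, fun e => h1 x e.symm, ((h2 x _).2 (.inr rfl)).symm, rfl⟩ : _ = _).symm)
    (fun i => ⟨⟨i, ⟨0, pos i⟩⟩, rfl⟩)
    Quot.mk_surjective
    (by
      intro g hg hg'
      refine ⟨Quot.lift (fun i => g ⟨i, ⟨0, pos i⟩⟩) ?_, ?_⟩
      · rintro i j ⟨e, hi, hj⟩
        obtain ⟨x, rfl, rfl⟩ := Dart.exists_of_mem hi
        obtain ⟨y, rfl, hy⟩ := Dart.exists_of_mem hj
        rw [← eq_of_next_invariant g hg x.1 x.2, ← eq_of_next_invariant g hg y.1 y.2]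
        rcases (h2 x y).1 hy with rfl | rfl
        · rfl
        · exact (hg' x).symm
      · funext x
        exact eq_of_next_invariant g hg x.1 x.2)
    (by
      intro i
      have : Nat.card {x : Dart C // x.1 = i} = (C.get i).ends.length := by
        rw [Nat.card_congr (Equiv.sigmaSubtype i)]
        simp
      rw [this]
      rcases ends_length (C.get i) with h | h
      · exact ⟨2, h⟩
      · exact ⟨1, h⟩)
    (by
      rw [← Nat.card_eq_fintype_card (α := Edge C), ← Nat.card_eq_fintype_card (α := F),
        ← Nat.card_eq_fintype_card (α := P), Fintype.card_fin]
      exact hp)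
  refine ⟨o, fun x y hne hxy => ?_, ho'⟩
  rcases (h2 x y).1 hxy with rfl | rfl
  · exact absurd rfl hne
  · exact ho x

/-- Ends with label 0 are taken as incoming, those with label 1 as outgoing. Labels alternate around
a vertex, which is the pattern demanded by `Flow`; the counts keep track of the labels for the
comparison along edges. -/
theorem exists_flow (C : PDCode) : (∀ n ∈ C, ¬ n.IsVirtual) → ∀ o : Dart C → ZMod 2, (∀ x : Dart C, o x.next = o x + 1) →
    ∃ I O, Flow C I O ∧ (∀ e, I.count e = ∑ x : Dart C, if x.edge = e ∧ o x = 0 then 1 else 0) ∧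
      ∀ e, O.count e = ∑ x : Dart C, if x.edge = e ∧ o x = 1 then 1 else 0 := by
  induction C with
  | nil => exact fun _ _ _ => ⟨[], [], .nil, fun _ => rfl, fun _ => rfl⟩
  | cons n C ih =>
    intro hv o ho
    obtain ⟨I, O, h, hI, hO⟩ := ih (fun m hm => hv m (by simp [hm])) (fun x => o ⟨x.1.succ, x.2⟩)
      fun x => ho ⟨x.1.succ, x.2⟩
    have hI' : ∀ e, I.count e = ∑ x : Dart C, if x.edge = e ∧ o ⟨x.1.succ, x.2⟩ = 0 then 1 else 0 := hI
    have z0 : ∀ a : ZMod 2, a = 0 ∨ a = 1 := by decide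
    rcases n with ⟨k, a, b, c, d⟩ | ⟨a, b⟩
    · have hk : k ≠ .virt := hv (.crossing k a b c d) (by simp)
      let d0 : Fin 4 → Dart (.crossing k a b c d :: C) := fun j => ⟨(0 : Fin (C.length + 1)), j⟩
      have o1 : o (d0 1) = o (d0 0) + 1 := ho (d0 0)
      have o2 : o (d0 2) = o (d0 1) + 1 := ho (d0 1)
      have o3 : o (d0 3) = o (d0 2) + 1 := ho (d0 2)
      have hs : ∀ f : Dart (.crossing k a b c d :: C) → ℕ, ∑ x, f x = (f (d0 0) + f (d0 1) + f (d0 2) + f (d0 3)) +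
          ∑ x : Dart C, f ⟨x.1.succ, x.2⟩ := fun f => by
        rw [sum_dart_cons]
        congr 1
        exact Fin.sum_univ_four _
      have ed : ∀ x : Dart C, Dart.edge (C := .crossing k a b c d :: C) ⟨x.1.succ, x.2⟩ = x.edge := fun x => rfl
      have e0 : (d0 0).edge = a := rfl
      have e1 : (d0 1).edge = b := rfl
      have e2 : (d0 2).edge = c := rfl
      have e3 : (d0 3).edge = d := rfl
      rcases z0 (o (d0 0)) with h0 | h0
      · have h1 : o (d0 1) = 1 := by rw [o1, h0]; rfl
        have h2 : o (d0 2) = 0 := by rw [o2, h1]; rfl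
        have h3 : o (d0 3) = 1 := by rw [o3, h2]; rfl
        refine ⟨_, _, .crossing k hk a b c d h, fun e => ?_, fun e => ?_⟩
        · simp only [hs, ed, e0, e1, e2, e3, h0, h1, h2, h3, List.count_cons, beq_iff_eq, hI]
          simp
          ring
        · simp only [hs, ed, e0, e1, e2, e3, h0, h1, h2, h3, List.count_cons, beq_iff_eq, hO]
          simp
          ring
      · have h1 : o (d0 1) = 0 := by rw [o1, h0]; rfl
        have h2 : o (d0 2) = 1 := by rw [o2, h1]; rfl
        have h3 : o (d0 3) = 0 := by rw [o3, h2]; rfl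
        refine ⟨_, _, .crossing_reverse k hk a b c d h, fun e => ?_, fun e => ?_⟩
        · simp only [hs, ed, e0, e1, e2, e3, h0, h1, h2, h3, List.count_cons, beq_iff_eq, hI]
          simp
          ring
        · simp only [hs, ed, e0, e1, e2, e3, h0, h1, h2, h3, List.count_cons, beq_iff_eq, hO]
          simp
          ring
    · let d0 : Fin 2 → Dart (.join a b :: C) := fun j => ⟨(0 : Fin (C.length + 1)), j⟩
      have o1 : o (d0 1) = o (d0 0) + 1 := ho (d0 0)
      have hs : ∀ f : Dart (.join a b :: C) → ℕ, ∑ x, f x = (f (d0 0) + f (d0 1)) +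
          ∑ x : Dart C, f ⟨x.1.succ, x.2⟩ := fun f => by
        rw [sum_dart_cons]
        congr 1
      have ed : ∀ x : Dart C, Dart.edge (C := .join a b :: C) ⟨x.1.succ, x.2⟩ = x.edge := fun x => rfl
      have e0 : (d0 0).edge = a := rfl
      have e1 : (d0 1).edge = b := rfl
      rcases z0 (o (d0 0)) with h0 | h0
      · have h1 : o (d0 1) = 1 := by rw [o1, h0]; rfl
        refine ⟨_, _, .join a b h, fun e => ?_, fun e => ?_⟩
        · simp only [hs, ed, e0, e1, h0, h1, List.count_cons, beq_iff_eq, hI]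
          simp
          ring
        · simp only [hs, ed, e0, e1, h0, h1, List.count_cons, beq_iff_eq, hO]
          simp
          ring
      · have h1 : o (d0 1) = 0 := by rw [o1, h0]; rfl
        refine ⟨_, _, .join_reverse a b h, fun e => ?_, fun e => ?_⟩
        · simp only [hs, ed, e0, e1, h0, h1, List.count_cons, beq_iff_eq, hI]
          simp
          ring
        · simp only [hs, ed, e0, e1, h0, h1, List.count_cons, beq_iff_eq, hO]
          simp
          ring

/-- The two ends of an edge carry different labels, so each edge is incoming exactly once and
outgoing exactly once. -/
theorem IsPlanar.sourceSink {C : PDCode} (hp : IsPlanar C) (h : TwoEnds C) (hC : ∀ n ∈ C, ¬ n.IsVirtual) :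
    SourceSink C := by
  obtain ⟨o, ho, ho'⟩ := hp.exists_alternating h
  obtain ⟨I, O, hF, hI, hO⟩ := exists_flow C hC o ho'
  obtain ⟨opp, h1, h2⟩ := h.exists_opp
  have key : ∀ e, I.count e = O.count e ∧ I.count e ≤ 1 := by
    intro e
    rw [hI, hO]
    simp only [← Finset.card_filter]
    by_cases hx : ∃ x : Dart C, x.edge = e
    · obtain ⟨x, rfl⟩ := hx
      have ho2 : o (opp x) = o x + 1 := ho x _ (h1 x) ((h2 x _).2 (.inr rfl))
      have hfilter : ∀ p : ZMod 2, (Finset.univ.filter fun y : Dart C => y.edge = x.edge ∧ o y = p) =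
          if o x = p then {x} else {opp x} := by
        intro p
        ext y
        have d1 : ∀ a p : ZMod 2, a + 1 = p ↔ a ≠ p := by decide
        have hne := h1 x
        simp only [Finset.mem_filter, Finset.mem_univ, true_and, h2 x y]
        split_ifs with hp
        · rw [Finset.mem_singleton]
          constructor
          · rintro ⟨rfl | rfl, h⟩
            · rfl
            · rw [ho2, d1] at h
              exact absurd hp h
          · rintro rfl
            exact ⟨.inl rfl, hp⟩
        · rw [Finset.mem_singleton]
          constructor
          · rintro ⟨rfl | rfl, h⟩
            · exact absurd h hp
            · rfl
          · rintro rfl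
            exact ⟨.inr rfl, by rw [ho2, d1]; exact hp⟩
      rw [hfilter, hfilter]
      split_ifs <;> simp
    · have : ∀ p : ZMod 2, (Finset.univ.filter fun y : Dart C => y.edge = e ∧ o y = p) = ∅ := by
        intro p
        refine Finset.filter_eq_empty_iff.2 ?_
        rintro y - ⟨hy, -⟩
        exact hx ⟨y, hy⟩
      simp [this]
  exact ⟨I, O, hF, List.nodup_iff_count_le_one.2 fun e => (key e).2, List.perm_iff_count.2 fun e => (key e).1⟩

end PDCode

/-! ### Coefficients of powers of the loop value. -/

section LoopPower

open LaurentPolynomial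

theorem coeff_loop_pow_succ (m : ℕ) (e : ℤ) : ((-T 2 - T (-2) : LaurentPolynomial ℤ) ^ (m + 1)).coeff e =
    -((-T 2 - T (-2) : LaurentPolynomial ℤ) ^ m).coeff (e - 2) -
      ((-T 2 - T (-2) : LaurentPolynomial ℤ) ^ m).coeff (e + 2) := by
  have h : (-T 2 - T (-2) : LaurentPolynomial ℤ) ^ (m + 1) =
      -(T 2 * (-T 2 - T (-2)) ^ m) + -(T (-2) * (-T 2 - T (-2)) ^ m) := by
    ring
  rw [h, AddMonoidAlgebra.coeff_add, Finsupp.add_apply, AddMonoidAlgebra.coeff_neg, AddMonoidAlgebra.coeff_neg,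
    Finsupp.neg_apply, Finsupp.neg_apply, coeff_T_mul, coeff_T_mul, sub_neg_eq_add]
  ring

theorem coeff_loop_pow_zero (e : ℤ) : ((-T 2 - T (-2) : LaurentPolynomial ℤ) ^ 0).coeff e = if 0 = e then 1 else 0 := by
  rw [pow_zero, ← T_zero, T_apply]

theorem coeff_loop_pow_of_lt (m : ℕ) : ∀ e : ℤ, 2 * m < e → ((-T 2 - T (-2) : LaurentPolynomial ℤ) ^ m).coeff e = 0 := by
  induction m with
  | zero =>
    intro e he
    rw [coeff_loop_pow_zero, if_neg]
    rintro rfl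
    simp at he
  | succ m ih =>
    intro e he
    push_cast at he
    rw [coeff_loop_pow_succ, ih _ (by linarith), ih _ (by linarith)]
    simp

theorem coeff_loop_pow_top (m : ℕ) : ((-T 2 - T (-2) : LaurentPolynomial ℤ) ^ m).coeff (2 * m) ≠ 0 := by
  induction m with
  | zero => simp
  | succ m ih =>
    rw [coeff_loop_pow_succ, coeff_loop_pow_of_lt m (2 * ((m + 1 : ℕ) : ℤ) + 2) (by push_cast; linarith)]
    have : (2 * ((m + 1 : ℕ) : ℤ) - 2) = 2 * m := by push_cast; ring
    rw [this]
    simpa using ih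

theorem coeff_loop_pow_mod (m : ℕ) : ∀ e : ℤ, ((-T 2 - T (-2) : LaurentPolynomial ℤ) ^ m).coeff e ≠ 0 →
    (4 : ℤ) ∣ e - 2 * m := by
  induction m with
  | zero =>
    intro e he
    rw [coeff_loop_pow_zero] at he
    have : 0 = e := by by_contra h; simp [h] at he
    simp [← this]
  | succ m ih =>
    intro e he
    rw [coeff_loop_pow_succ] at he
    have h : ((-T 2 - T (-2) : LaurentPolynomial ℤ) ^ m).coeff (e - 2) ≠ 0 ∨
        ((-T 2 - T (-2) : LaurentPolynomial ℤ) ^ m).coeff (e + 2) ≠ 0 := by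
      by_contra! h
      rw [h.1, h.2] at he
      simp at he
    push_cast
    rcases h with h | h
    · have := ih _ h
      omega
    · have := ih _ h
      omega

end LoopPower

/-! ### Degrees of the bracket, and adequacy. -/

namespace PDCode

open DiagramNode LaurentPolynomial

/-- The code in which all real crossings are spliced in the same way. -/
def spliceAll (X : Splice) (C : PDCode) : PDCode := C.flatMap (spliceBy X)

@[simp] theorem spliceAll_nil (X : Splice) : spliceAll X [] = [] := rfl

@[simp] theorem spliceAll_cons (X : Splice) (n : DiagramNode) (C : PDCode) :
    spliceAll X (n :: C) = n.spliceBy X ++ spliceAll X C := rfl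

theorem spliceAll_perm (X : Splice) {C E : PDCode} (h : C.Perm E) : (spliceAll X C).Perm (spliceAll X E) :=
  h.flatMap_right _

theorem not_isReal_of_mem_spliceAll {X : Splice} {C : PDCode} {m : DiagramNode} (h : m ∈ spliceAll X C) :
    ¬ m.IsReal := by
  obtain ⟨n, -, hm⟩ := List.mem_flatMap.1 h
  exact not_isReal_of_mem_spliceBy hm

/-- The number of real crossings. -/
def numReal (C : PDCode) : ℕ := C.countP fun n => decide n.IsReal

theorem numReal_cons_real {n : DiagramNode} (hn : n.IsReal) (C : PDCode) : numReal (n :: C) = numReal C + 1 := by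
  simp [numReal, hn]

theorem numReal_cons_not_real {n : DiagramNode} (hn : ¬ n.IsReal) (C : PDCode) : numReal (n :: C) = numReal C := by
  simp [numReal, hn]

theorem coeff_skein_cons {X : Splice} {n : DiagramNode} (hn : n.IsReal) (C L : PDCode) (e : ℤ) :
    (skein X (n :: C) L).coeff e = (skein X C (n.spliceBy X ++ L)).coeff (e - 1) +
      (skein X C (n.spliceBy X.other ++ L)).coeff (e + 1) := by
  rw [skein_cons_real X hn, AddMonoidAlgebra.coeff_add, Finsupp.add_apply, coeff_T_mul, coeff_T_mul, sub_neg_eq_add]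

theorem numComponents_spliceAll_cons (X : Splice) (n : DiagramNode) (C L : PDCode) :
    numComponents (spliceAll X (n :: C) ++ L) = numComponents (spliceAll X C ++ (n.spliceBy X ++ L)) := by
  rw [spliceAll_cons, List.append_assoc]
  exact numComponents_perm (List.perm_append_comm_assoc _ _ _)

theorem numComponents_comm (A B L : PDCode) : numComponents (A ++ (B ++ L)) = numComponents (B ++ (A ++ L)) :=
  numComponents_perm (List.perm_append_comm_assoc _ _ _)

/-- Leaving the all-`X` state at one crossing lowers the exponent by 2 and raises the loop degree by
at most 2, so no state exceeds the top degree of the all-`X` state. -/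
theorem coeff_skein_of_lt (X : Splice) (C : PDCode) : ∀ (L : PDCode) (e : ℤ),
    (numReal C + 2 * (numComponents (spliceAll X C ++ L) - 1 : ℕ) : ℤ) < e → (skein X C L).coeff e = 0 := by
  induction C with
  | nil =>
    intro L e he
    exact coeff_loop_pow_of_lt _ _ (by simpa [numReal] using he)
  | cons n C ih =>
    intro L e he
    rw [numComponents_spliceAll_cons] at he
    by_cases hn : n.IsReal
    · rw [numReal_cons_real hn] at he
      have h1 : numComponents (spliceAll X C ++ (n.spliceBy X.other ++ L)) ≤
          numComponents (spliceAll X C ++ (n.spliceBy X ++ L)) + 1 := by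
        rw [numComponents_comm, numComponents_comm (spliceAll X C)]
        have := numComponents_splice_le X.other n (spliceAll X C ++ L)
        cases X <;> exact this
      rw [coeff_skein_cons hn, ih _ _ (by omega), ih _ _ (by omega), add_zero]
    · rw [numReal_cons_not_real hn, spliceBy_of_not_isReal hn] at he
      rw [skein_cons_not_real X hn]
      exact ih _ _ he

/-- Changing the splice of one crossing in the state `X` does not increase the number of
components. -/
def WeaklyAdequate (X : Splice) (C L : PDCode) : Prop := ∀ n R, n.IsReal → C.Perm (n :: R) →
  numComponents (n.spliceBy X.other ++ (spliceAll X R ++ L)) ≤ numComponents (spliceAll X C ++ L)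

theorem WeaklyAdequate.tail {X : Splice} {n : DiagramNode} {C L : PDCode} (h : WeaklyAdequate X (n :: C) L) :
    WeaklyAdequate X C (n.spliceBy X ++ L) := by
  intro m R hm hR
  have h1 := h m (n :: R) hm ((hR.cons n).trans (.swap _ _ _))
  rw [numComponents_spliceAll_cons] at h1
  refine le_trans (le_of_eq (numComponents_perm ?_)) h1
  rw [spliceAll_cons, List.append_assoc]
  exact (List.perm_append_comm_assoc _ _ _).append_left _

/-- Under weak adequacy the first departure from `X` does not raise the loop degree, so that branch
stays strictly below the top degree, whatever is spliced afterwards. The leading term of the all-`X`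
state is not cancelled. -/
theorem coeff_skein_top (X : Splice) (C : PDCode) : ∀ L : PDCode, WeaklyAdequate X C L →
    (skein X C L).coeff (numReal C + 2 * (numComponents (spliceAll X C ++ L) - 1 : ℕ) : ℤ) ≠ 0 := by
  induction C with
  | nil =>
    intro L _
    simpa [numReal, skein_nil] using coeff_loop_pow_top (numComponents L - 1)
  | cons n C ih =>
    intro L h
    by_cases hn : n.IsReal
    · have h1 := h n C hn (.refl _)
      rw [numComponents_comm] at h1
      rw [numComponents_spliceAll_cons] at h1 ⊢
      rw [coeff_skein_cons hn, numReal_cons_real hn, coeff_skein_of_lt X C (n.spliceBy X.other ++ L) _ (by omega), add_zero]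
      convert ih _ h.tail using 2
      push_cast
      ring
    · have h1 := h.tail
      rw [numComponents_spliceAll_cons, skein_cons_not_real X hn, numReal_cons_not_real hn]
      rw [spliceBy_of_not_isReal hn] at h1 ⊢
      exact ih _ h1

theorem SourceSink.spliceAll {C : PDCode} (X : Splice) : ∀ {L : PDCode}, SourceSink (C ++ L) →
    SourceSink (spliceAll X C ++ L) := by
  induction C with
  | nil => exact fun h => h
  | cons n C ih =>
    intro L h
    have h1 := (h.splice X).perm (List.perm_append_comm_assoc _ _ _)
    refine (ih h1).perm ?_
    rw [spliceAll_cons, List.append_assoc]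
    exact List.perm_append_comm_assoc _ _ _

/-- By `SourceSink.tangle` a change of splice alters the number of components by exactly one. The
exponent and the loop degree then both change by 2, so the total changes by 0 or 4 up to sign;
within one power of the loop value the exponents agree modulo 4. -/
theorem SourceSink.coeff_skein_mod {C : PDCode} : ∀ {L : PDCode}, SourceSink (C ++ L) → (∀ m ∈ L, ¬ m.IsReal) →
    ∀ e, (skein .A C L).coeff e ≠ 0 →
      (4 : ℤ) ∣ e - (numReal C + 2 * (numComponents (PDCode.spliceAll .A C ++ L) - 1 : ℕ)) := by
  induction C with
  | nil =>
    intro L _ _ e he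
    simpa [numReal] using coeff_loop_pow_mod _ _ he
  | cons n C ih =>
    intro L h hL e he
    have hS : ∀ X, SourceSink (C ++ (n.spliceBy X ++ L)) := fun X =>
      (h.splice X).perm (List.perm_append_comm_assoc _ _ _)
    have hL' : ∀ X, ∀ m ∈ n.spliceBy X ++ L, ¬ m.IsReal := by
      intro X m hm
      rcases List.mem_append.1 hm with hm | hm
      · exact not_isReal_of_mem_spliceBy hm
      · exact hL m hm
    rw [numComponents_spliceAll_cons]
    by_cases hn : n.IsReal
    · have h0 : SourceSink (n :: (PDCode.spliceAll .A C ++ L)) := by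
        have h1 : SourceSink (C ++ (n :: L)) := h.perm List.perm_middle.symm
        exact (h1.spliceAll .A).perm List.perm_middle
      obtain ⟨k, h1, -⟩ := h0.tangle hn (fun m hm => by
        rcases List.mem_append.1 hm with hm | hm
        · exact not_isReal_of_mem_spliceAll hm
        · exact hL m hm) .A
      rw [numComponents_comm, numComponents_comm (spliceBy _ n)] at h1
      rw [coeff_skein_cons hn] at he
      rw [numReal_cons_real hn]
      have h2 : (skein .A C (n.spliceBy .A ++ L)).coeff (e - 1) ≠ 0 ∨
          (skein .A C (n.spliceBy Splice.A.other ++ L)).coeff (e + 1) ≠ 0 := by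
        by_contra! h
        rw [h.1, h.2] at he
        simp at he
      rcases h2 with h2 | h2
      · have := ih (hS _) (hL' _) _ h2
        push_cast
        omega
      · have := ih (hS _) (hL' _) _ h2
        push_cast
        omega
    · rw [skein_cons_not_real _ hn] at he
      rw [numReal_cons_not_real hn]
      have h1 := hS .A
      have h2 := hL' .A
      rw [spliceBy_of_not_isReal hn] at h1 h2 ⊢
      exact ih h1 h2 _ he

theorem SourceSink.four_dvd_span {C : PDCode} (h : SourceSink C) : (4 : ℤ) ∣ laurentSpan (bracket C) := by
  rw [bracket_eq_skein]
  exact four_dvd_laurentSpan _ (SourceSink.coeff_skein_mod (L := []) (by rwa [List.append_nil]) (by simp))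

/-- The span of the bracket is determined by the states all-`A` and all-`B` if these are weakly adequate. -/
theorem laurentSpan_bracket {C : PDCode} (hA : WeaklyAdequate .A C []) (hB : WeaklyAdequate .B C []) :
    laurentSpan (bracket C) = 2 * numReal C + 2 * (numComponents (spliceAll .A C) - 1 : ℕ) +
      2 * (numComponents (spliceAll .B C) - 1 : ℕ) := by
  have tA := coeff_skein_top .A C [] hA
  have tB := coeff_skein_top .B C [] hB
  have lA := coeff_skein_of_lt .A C []
  have lB := coeff_skein_of_lt .B C []
  -- The lowest term is the top term for the exchanged splices, read with the opposite exponent.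
  have inv : ∀ e, (skein .B C []).coeff e = (skein .A C []).coeff (-e) := by
    intro e
    rw [skein_B_eq_invert, invert_apply]
  simp only [inv, List.append_nil] at tA tB lA lB
  rw [bracket_eq_skein, laurentSpan_eq tA tB]
  · ring
  · intro e he
    constructor
    · by_contra! h
      exact he (by simpa using lB (-e) (by linarith))
    · by_contra! h
      exact he (lA e h)

theorem stateComponents_constState (C : PDCode) (X : Splice) :
    stateComponents C (constState C X) = numComponents (spliceAll X C) := by
  have h : splice C (constState C X) = spliceAll X C := by
    have h1 : C = (List.finRange C.length).map C.get := by simp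
    conv_rhs => rw [h1, spliceAll, List.flatMap_map]
    rw [splice]
    congr 1
    funext i
    split_ifs with hi
    · cases X <;> rfl
    · exact (spliceBy_of_not_isReal hi X).symm
  rw [stateComponents, h]

theorem stateComponents_update (C : PDCode) (X : Splice) (p : RealCrossing C) {R : PDCode} (hR : C.Perm (C.get p.1 :: R)) :
    stateComponents C (Function.update (constState C X) p X.other) =
      numComponents ((C.get p.1).spliceBy X.other ++ spliceAll X R) := by
  rw [stateComponents]
  refine numComponents_perm ?_
  have h1 : C = (List.finRange C.length).map C.get := by simp
  have h2 : (List.finRange C.length).Perm (p.1 :: (List.finRange C.length).erase p.1) :=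
    List.perm_cons_erase (List.mem_finRange _)
  have h3 : R.Perm (((List.finRange C.length).erase p.1).map C.get) := by
    have h4 := h2.map C.get
    rw [← h1] at h4
    exact (hR.symm.trans h4).cons_inv
  refine (h2.flatMap_right _).trans ?_
  rw [List.flatMap_cons]
  refine List.Perm.append (List.Perm.of_eq ?_) (List.Perm.trans (List.Perm.of_eq ?_) (spliceAll_perm X h3.symm))
  · rw [dif_pos p.2]
    simp only [Subtype.coe_eta, Function.update_self]
    cases X <;> rfl
  · rw [spliceAll, List.flatMap_map]
    refine List.flatMap_congr fun i hi => ?_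
    have hne : i ≠ p.1 := by
      rintro rfl
      exact (List.nodup_finRange _).not_mem_erase hi
    split_ifs with hr
    · rw [Function.update_of_ne (fun h => hne (congrArg Subtype.val h))]
      cases X <;> rfl
    · exact (spliceBy_of_not_isReal hr X).symm

/-- Changing the splice of one crossing in the state `X` lowers the number of components. -/
def StrictlyAdequate (X : Splice) (C : PDCode) : Prop := ∀ n R, n.IsReal → C.Perm (n :: R) →
  numComponents (n.spliceBy X.other ++ spliceAll X R) < numComponents (spliceAll X C)

/-- Passes from states, which are indexed by positions in the code, to a form that does not depend
on the order of the vertices. -/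
theorem strictlyAdequate_of_lt {X : Splice} {C : PDCode} (h : ∀ p : RealCrossing C,
    stateComponents C (Function.update (constState C X) p X.other) < stateComponents C (constState C X)) :
    StrictlyAdequate X C := by
  intro n R hn hR
  obtain ⟨i, rfl⟩ := List.get_of_mem (hR.mem_iff.2 (List.mem_cons_self (l := R)))
  have := h ⟨i, hn⟩
  rwa [stateComponents_update C X ⟨i, hn⟩ hR, stateComponents_constState] at this

theorem StrictlyAdequate.weaklyAdequate {X : Splice} {C : PDCode} (h : StrictlyAdequate X C) :
    WeaklyAdequate X C [] := by
  intro n R hn hR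
  rw [List.append_nil, List.append_nil]
  exact (h n R hn hR).le

theorem not_isReal_virtualize (n : DiagramNode) : ¬ n.virtualize.IsReal := by
  cases n <;> simp [virtualize, IsReal]

theorem SourceSink.numComponents_virtualize {n : DiagramNode} {C : PDCode} (h : SourceSink (n :: C)) (hn : n.IsReal)
    (hC : ∀ m ∈ C, ¬ m.IsReal) (X : Splice) :
    0 < numComponents (n.virtualize :: C) ∧ numComponents (n.virtualize :: C) ≤ numComponents (n.spliceBy X ++ C) ∧
      (numComponents (n.spliceBy X.other ++ C) < numComponents (n.spliceBy X ++ C) →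
        numComponents (n.spliceBy X ++ C) = numComponents (n.virtualize :: C) + 1) := by
  obtain ⟨k, h1, h2⟩ := h.tangle hn hC X
  omega

/-- Making a crossing virtual in a strictly adequate code with an alternating orientation leads to a weakly adequate
code. -/
theorem StrictlyAdequate.virtualize {X : Splice} {C R : PDCode} {n : DiagramNode} (h : StrictlyAdequate X C)
    (hC : SourceSink C) (hn : n.IsReal) (hR : C.Perm (n :: R)) :
    0 < numComponents (spliceAll X (n.virtualize :: R)) ∧
      numComponents (spliceAll X C) = numComponents (spliceAll X (n.virtualize :: R)) + 1 ∧
      WeaklyAdequate X (n.virtualize :: R) [] := by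
  have hC1 : SourceSink (n :: PDCode.spliceAll X R) := by
    have h1 : SourceSink (R ++ [n]) := hC.perm (hR.trans (List.perm_append_singleton n R).symm)
    exact (h1.spliceAll X).perm (List.perm_append_singleton _ _)
  have hv : ∀ S, PDCode.spliceAll X (n.virtualize :: S) = n.virtualize :: PDCode.spliceAll X S := fun S => by
    rw [spliceAll_cons, spliceBy_of_not_isReal (not_isReal_virtualize n)]
    rfl
  -- Adequacy at `n` says that its `X`-splice has the larger count, so virtualizing loses exactly
  -- one component.
  obtain ⟨h1, -, h3⟩ := hC1.numComponents_virtualize hn (fun m hm => not_isReal_of_mem_spliceAll hm) X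
  have h4 := h n R hn hR
  rw [numComponents_perm (spliceAll_perm X hR), spliceAll_cons] at h4
  have h5 := h3 h4
  rw [hv, numComponents_perm (spliceAll_perm X hR), spliceAll_cons]
  refine ⟨h1, h5, ?_⟩
  intro m S hm hS
  rw [List.append_nil, List.append_nil, hv]
  have hmR : m ∈ R := by
    have : m ∈ n.virtualize :: R := hS.mem_iff.2 (List.mem_cons_self (l := S))
    rcases List.mem_cons.1 this with rfl | h
    · exact absurd hm (not_isReal_virtualize n)
    · exact h
  obtain ⟨Q, hQ⟩ : ∃ Q, R.Perm (m :: Q) := by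
    obtain ⟨S₁, S₂, hS⟩ := List.append_of_mem hmR
    exact ⟨S₁ ++ S₂, hS ▸ List.perm_middle⟩
  have hSQ : S.Perm (n.virtualize :: Q) := by
    have h6 := hS.symm.trans ((hQ.cons _).trans (.swap _ _ _))
    exact h6.cons_inv
  have e1 : numComponents (m.spliceBy X.other ++ PDCode.spliceAll X S) =
      numComponents (n.virtualize :: (m.spliceBy X.other ++ PDCode.spliceAll X Q)) := by
    refine numComponents_perm (((spliceAll_perm X hSQ).append_left _).trans ?_)
    rw [hv]
    exact List.perm_middle
  have hC2 : SourceSink (n :: (m.spliceBy X.other ++ PDCode.spliceAll X Q)) := by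
    have h6 : SourceSink (m :: (Q ++ [n])) := hC.perm (by
      refine hR.trans ((hQ.cons n).trans ((List.Perm.swap _ _ _).trans ?_))
      exact (List.perm_append_singleton n Q).symm.cons _)
    have h7 := (h6.splice X.other).perm (List.perm_append_comm_assoc _ _ _)
    refine (h7.spliceAll X).perm ((List.perm_append_comm_assoc _ _ _).trans ?_)
    refine (List.Perm.append_left _ (List.perm_append_singleton _ _)).trans List.perm_middle
  -- With `m` switched, virtualizing `n` does not increase the count. By adequacy at `m` it was
  -- below the all-`X` count of `C`, which exceeds the virtualized one by one; only a weak
  -- inequality remains.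
  obtain ⟨-, h8, -⟩ := hC2.numComponents_virtualize hn (fun k hk => by
    rcases List.mem_append.1 hk with hk | hk
    · exact not_isReal_of_mem_spliceBy hk
    · exact not_isReal_of_mem_spliceAll hk) X
  have h9 := h m (n :: Q) hm (hR.trans ((hQ.cons n).trans (.swap _ _ _)))
  rw [spliceAll_cons, numComponents_comm, numComponents_perm (spliceAll_perm X hR), spliceAll_cons] at h9
  omega

end PDCode

/-! ### The span of a virtualized adequate diagram. -/

namespace VirtualLinkDiagram

open PDCode

theorem IsClassical.four_dvd_bracketSpan {D : VirtualLinkDiagram} (hD : D.IsClassical) : (4 : ℤ) ∣ D.bracketSpan :=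
  (D.planar.sourceSink D.two_ends hD).four_dvd_span

theorem RepresentsClassicalLink.four_dvd_bracketSpan {D : VirtualLinkDiagram} (hD : D.RepresentsClassicalLink) :
    (4 : ℤ) ∣ D.bracketSpan := by
  obtain ⟨E, hE, h⟩ := hD
  rw [h.bracketSpan_eq]
  exact hE.four_dvd_bracketSpan

/-- In the span formula the number of real crossings and the two extreme component counts each drop
by one, and each enters with the factor 2. -/
theorem IsVirtualizationOf.bracketSpan_eq {D D' : VirtualLinkDiagram} (hD : D.IsVirtualizationOf D')
    (hclassical : D'.IsClassical) (hadequate : D'.IsAdequate) : D.bracketSpan = D'.bracketSpan - 6 := by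
  obtain ⟨⟨i, hi⟩, hp⟩ := hD
  have hC := D'.planar.sourceSink D'.two_ends hclassical
  have hR : D'.code.Perm (D'.code.get i :: D'.code.eraseIdx i) := (List.getElem_cons_eraseIdx_perm i.2).symm
  have hE : D.code.Perm ((D'.code.get i).virtualize :: D'.code.eraseIdx i) := by
    rw [hp]
    exact List.set_perm_cons_eraseIdx i.2 _
  have aA : StrictlyAdequate .A D'.code := strictlyAdequate_of_lt hadequate.1
  have aB : StrictlyAdequate .B D'.code := strictlyAdequate_of_lt hadequate.2
  obtain ⟨pA, eA, wA⟩ := aA.virtualize hC hi hR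
  obtain ⟨pB, eB, wB⟩ := aB.virtualize hC hi hR
  have hb : bracket D.code = bracket ((D'.code.get i).virtualize :: D'.code.eraseIdx i) := by
    rw [bracket_eq_skein, bracket_eq_skein, skein_perm_left _ hE]
  have hr : numReal D'.code = numReal ((D'.code.get i).virtualize :: D'.code.eraseIdx i) + 1 := by
    rw [numReal_cons_not_real (not_isReal_virtualize _), ← numReal_cons_real hi]
    exact hR.countP_eq _
  rw [bracketSpan, bracketSpan, hb, laurentSpan_bracket wA wB,
    laurentSpan_bracket aA.weaklyAdequate aB.weaklyAdequate]
  -- The positivity statements `pA` and `pB` make the truncated subtractions exact.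
  omega

end VirtualLinkDiagram

theorem mainTheorem3 (D D' : VirtualLinkDiagram) (hclassical : D'.IsClassical)
    (hadequate : D'.IsAdequate) (hD : D.IsVirtualizationOf D') :
    ¬ D.RepresentsClassicalLink ∧
      D.bracketSpan = D'.bracketSpan - 6 ∧
      ¬ (4 : ℤ) ∣ D.bracketSpan ∧
      ∀ E : VirtualLinkDiagram, E.RepresentsClassicalLink → (4 : ℤ) ∣ E.bracketSpan := by
  have hspan := hD.bracketSpan_eq hclassical hadequate
  have hnot : ¬ (4 : ℤ) ∣ D.bracketSpan := by
    -- The span of `D'` is divisible by 4, so that of `D` is congruent to 2 modulo 4.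
    have := hclassical.four_dvd_bracketSpan
    omega
  exact ⟨fun h => hnot h.four_dvd_bracketSpan, hspan, hnot, fun E hE => hE.four_dvd_bracketSpan⟩
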